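/- Let $G\subset\mathbb R^n$ be a convex domain and let $T_G=\{z=x+iy\in\mathbb C^n:\ x\in\mathbb R^n,\ y\in G\}$ be the tube domain over it. Put $d^c=\frac1{4i}(\partial-\bar\partial)$, so that $dd^c=\frac i2\partial\bar\partial$, and let $m_n$ be Lebesgue measure on $\mathbb R^n$ (in the variable $x$). Let $$F=\frac i2\sum_{j,k=1}^n F_{jk}\,dz_j\wedge d\bar z_k$$ be a closed positive current of bidegree $(1,1)$ on $T_G$ whose coefficients have the form $F_{jk}=\hat F_{jk}\otimes m_n$, where each $\hat F_{jk}$ is a complex Radon measure on $G$ (locally finite, i.e. a distribution of order $0$ on $G$). Then there exist a convex function $A$ on $G$ and real constants $c_{jk}$, $1\le j<k\le n$, such that $$F=dd^c\Big(A(y)+\sum_{1\le j<k\le n}2c_{jk}\,(x_jy_k-y_jx_k)\Big)$$ in the sense of currents on $T_G$. -/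

import Mathlib

open MeasureTheory TopologicalSpace

noncomputable section

namespace Tube

/-- The real vector space of (complex-valued, real-multilinear) alternating `k`-forms on `ℂⁿ`. -/
abbrev Form (n k : ℕ) : Type := (Fin n → ℂ) [⋀^Fin k]→L[ℝ] ℂ

/-- Complex-valued distributions on an open subset of `ℂⁿ` (acting on real test functions of class
`C^∞` with compact support in `Ω`). -/
abbrev Distr {n : ℕ} (Ω : Opens (Fin n → ℂ)) : Type := Distribution Ω ℂ ⊤

/-- Currents of degree `k` on an open subset of `ℂⁿ`, as differential forms of degree `k` with
distribution coefficients: distributions with values in the space of alternating `k`-forms. -/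
abbrev Current {n : ℕ} (Ω : Opens (Fin n → ℂ)) (k : ℕ) : Type := Distribution Ω (Form n k) ⊤

/-! ### Constant forms -/

/-- The one-form `dx_j`. -/
def dx {n : ℕ} (j : Fin n) : (Fin n → ℂ) →L[ℝ] ℂ :=
  Complex.ofRealCLM ∘L Complex.reCLM ∘L ContinuousLinearMap.proj j

/-- The one-form `dy_j`. -/
def dy {n : ℕ} (j : Fin n) : (Fin n → ℂ) →L[ℝ] ℂ :=
  Complex.ofRealCLM ∘L Complex.imCLM ∘L ContinuousLinearMap.proj j

/-- The one-form `dz_j = dx_j + i dy_j`. -/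
def dz {n : ℕ} (j : Fin n) : (Fin n → ℂ) →L[ℝ] ℂ := dx j + Complex.I • dy j

/-- The one-form `dz̄_j = dx_j - i dy_j`. -/
def dzbar {n : ℕ} (j : Fin n) : (Fin n → ℂ) →L[ℝ] ℂ := dx j - Complex.I • dy j

/-- Exterior multiplication `ω ↦ α ∧ ω` by a one-form `α`:
`(α ∧ ω)(v₀, …, v_k) = ∑ i, (-1)^i α(v_i) ω(v₀, …, v̂_i, …, v_k)`. -/
def wedge {n k : ℕ} (α : (Fin n → ℂ) →L[ℝ] ℂ) : Form n k →L[ℝ] Form n (k + 1) :=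
  ContinuousAlternatingMap.alternatizeUncurryFinCLM ℝ (Fin n → ℂ) ℂ ∘L
    (ContinuousLinearMap.compL ℝ (Fin n → ℂ) ℂ (Form n k)).flip α ∘L
      (ContinuousLinearMap.lsmul ℝ ℂ : ℂ →L[ℝ] Form n k →L[ℝ] Form n k).flip

/-- Complex numbers as forms of degree `0`. -/
def form0 (n : ℕ) : ℂ →L[ℝ] Form n 0 :=
  (ContinuousAlternatingMap.constOfIsEmptyLIE ℝ (Fin n → ℂ) ℂ (Fin 0)).toContinuousLinearEquiv

/-- The two-form `dz_j ∧ dz̄_k`. -/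
def dzdzbar {n : ℕ} (j k : Fin n) : Form n 2 := wedge (dz j) (wedge (dzbar k) (form0 n 1))

/-! ### Differential operators on currents -/

section Operators

variable {n : ℕ} {Ω : Opens (Fin n → ℂ)} {k : ℕ}

/-- Multiplication of a current by a complex constant. -/
def cmul (c : ℂ) (T : Current Ω k) : Current Ω k :=
  Distribution.mapCLM (ContinuousLinearMap.lsmul ℝ ℂ c : Form n k →L[ℝ] Form n k) T

/-- Exterior multiplication `α ∧ T` of a current by a constant one-form. -/
def wedgeC (α : (Fin n → ℂ) →L[ℝ] ℂ) (T : Current Ω k) : Current Ω (k + 1) :=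
  Distribution.mapCLM (wedge α) T

/-- The derivative of (the coefficients of) a current with respect to `x_j`. -/
def pdx (j : Fin n) (T : Current Ω k) : Current Ω k :=
  Distribution.lineDerivCLM (Pi.single j (1 : ℂ)) T

/-- The derivative of (the coefficients of) a current with respect to `y_j`. -/
def pdy (j : Fin n) (T : Current Ω k) : Current Ω k :=
  Distribution.lineDerivCLM (Pi.single j Complex.I) T

/-- `∂/∂z_j = (∂/∂x_j - i ∂/∂y_j) / 2`. -/
def pdz (j : Fin n) (T : Current Ω k) : Current Ω k :=
  cmul (1 / 2) (pdx j T - cmul Complex.I (pdy j T))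

/-- `∂/∂z̄_j = (∂/∂x_j + i ∂/∂y_j) / 2`. -/
def pdzbar (j : Fin n) (T : Current Ω k) : Current Ω k :=
  cmul (1 / 2) (pdx j T + cmul Complex.I (pdy j T))

/-- The exterior derivative `dT = ∑ j, (dx_j ∧ ∂T/∂x_j + dy_j ∧ ∂T/∂y_j)`. -/
def extD (T : Current Ω k) : Current Ω (k + 1) :=
  ∑ j : Fin n, (wedgeC (dx j) (pdx j T) + wedgeC (dy j) (pdy j T))

/-- `∂T = ∑ j, dz_j ∧ ∂T/∂z_j`. -/
def del (T : Current Ω k) : Current Ω (k + 1) := ∑ j : Fin n, wedgeC (dz j) (pdz j T)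

/-- `∂̄T = ∑ j, dz̄_j ∧ ∂T/∂z̄_j`. -/
def delbar (T : Current Ω k) : Current Ω (k + 1) := ∑ j : Fin n, wedgeC (dzbar j) (pdzbar j T)

/-- The operator `d^c = (∂ - ∂̄) / (4i)`. -/
def extDc (T : Current Ω k) : Current Ω (k + 1) :=
  cmul (1 / (4 * Complex.I)) (del T - delbar T)

/-- A distribution as a current of degree `0`. -/
def current0 (T : Distr Ω) : Current Ω 0 := Distribution.mapCLM (form0 n) T

/-- The current `T` multiplied by a constant form `ω`, for a distribution `T`. -/
def distrForm (T : Distr Ω) (ω : Form n k) : Current Ω k :=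
  Distribution.mapCLM
    ((ContinuousLinearMap.lsmul ℝ ℂ : ℂ →L[ℝ] Form n k →L[ℝ] Form n k).flip ω) T

/-- The current of bidegree `(1,1)` with coefficients `F_{jk}`, normalized as
`F = (i/2) ∑ j k, F_{jk} dz_j ∧ dz̄_k`. -/
def current11 (Fc : Fin n → Fin n → Distr Ω) : Current Ω 2 :=
  cmul (Complex.I / 2) (∑ j : Fin n, ∑ l : Fin n, distrForm (Fc j l) (dzdzbar j l))

/-- A current is closed if its exterior derivative vanishes. -/
def IsClosedCurrent (T : Current Ω k) : Prop := extD T = 0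

/-- Positivity of a current of bidegree `(1,1)`: the restriction of `F` to each complex line is a
nonnegative multiple of the area form. For `F = (i/2) ∑ F_{jk} dz_j ∧ dz̄_k` one has
`F(v, iv) = ∑ j k, F_{jk} v_j conj(v_k)`, so this says that the distribution
`∑ j k, F_{jk} v_j conj(v_k)` is a positive measure for every `v ∈ ℂⁿ`. -/
def IsPositive11 (F : Current Ω 2) : Prop :=
  ∀ φ : TestFunction Ω ℝ ⊤, (∀ z, 0 ≤ φ z) → ∀ v : Fin n → ℂ,
    0 ≤ (F φ ![v, Complex.I • v]).re ∧ (F φ ![v, Complex.I • v]).im = 0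

/-- The distribution `φ ↦ ∫ φ dμ` of a positive measure which is finite on compact subsets
of `Ω`. -/
def distrOfMeasure (Ω : Opens (Fin n → ℂ)) (μ : Measure (Fin n → ℂ)) : Distr Ω :=
  TestFunction.integralAgainstBilinCLM (ContinuousLinearMap.lsmul ℝ ℝ : ℝ →L[ℝ] ℂ →L[ℝ] ℂ) μ
    (fun _ => (1 : ℂ))

/-- The distribution `φ ↦ ∫ φ u` of a (locally integrable) real function. -/
def distrOfFun (Ω : Opens (Fin n → ℂ)) (u : (Fin n → ℂ) → ℝ) : Distr Ω :=
  TestFunction.integralAgainstBilinCLM (ContinuousLinearMap.lsmul ℝ ℝ : ℝ →L[ℝ] ℂ →L[ℝ] ℂ) volume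
    (fun z => (u z : ℂ))

/-- `dd^c u` for a (locally integrable) real function `u`, in the sense of currents. -/
def ddc (Ω : Opens (Fin n → ℂ)) (u : (Fin n → ℂ) → ℝ) : Current Ω 2 :=
  extD (extDc (current0 (distrOfFun Ω u)))

end Operators

/-! ### Tube domains and measures on the base -/

/-- The real part `x` of `z = x + iy`. -/
def rePart {n : ℕ} (z : Fin n → ℂ) : Fin n → ℝ := fun j => (z j).re

/-- The imaginary part `y` of `z = x + iy`. -/
def imPart {n : ℕ} (z : Fin n → ℂ) : Fin n → ℝ := fun j => (z j).im

theorem continuous_imPart {n : ℕ} : Continuous (imPart : (Fin n → ℂ) → Fin n → ℝ) :=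
  continuous_pi fun j => Complex.continuous_im.comp (continuous_apply j)

/-- The tube domain `T_G = {x + iy : x ∈ ℝⁿ, y ∈ G}`. -/
def tube {n : ℕ} (G : Opens (Fin n → ℝ)) : Opens (Fin n → ℂ) :=
  ⟨imPart ⁻¹' (G : Set (Fin n → ℝ)), G.isOpen.preimage continuous_imPart⟩

/-- A complex Radon measure on `G`: a combination `(μ₁ - μ₂) + i (μ₃ - μ₄)` of positive Borel
measures on `G` that are locally finite on `G` (their total mass may be infinite). These are exactly
the complex distributions of order `0` on `G`. -/
structure RadonMeasure {n : ℕ} (G : Opens (Fin n → ℝ)) where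
  rePos : Measure G
  reNeg : Measure G
  imPos : Measure G
  imNeg : Measure G
  rePos_locallyFinite : IsLocallyFiniteMeasure rePos
  reNeg_locallyFinite : IsLocallyFiniteMeasure reNeg
  imPos_locallyFinite : IsLocallyFiniteMeasure imPos
  imNeg_locallyFinite : IsLocallyFiniteMeasure imNeg

/-- For a positive measure `μ` on `G`, the measure `μ ⊗ m_n` on `T_G` (as a measure on `ℂⁿ`
concentrated on `T_G`): the image of `m_n × μ` under `(x, y) ↦ x + iy`. -/
def tensorMeasure {n : ℕ} {G : Opens (Fin n → ℝ)} (μ : Measure G) : Measure (Fin n → ℂ) :=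
  ((volume : Measure (Fin n → ℝ)).prod μ).map
    (fun p => fun j => ((p.1 j : ℂ) + ((p.2 : Fin n → ℝ) j : ℂ) * Complex.I))

/-- The distribution `μ ⊗ m_n` on `T_G`, for a complex Radon measure `μ` on `G`. -/
def RadonMeasure.tensorLebesgue {n : ℕ} {G : Opens (Fin n → ℝ)} (μ : RadonMeasure G) :
    Distr (tube G) :=
  (distrOfMeasure (tube G) (tensorMeasure μ.rePos) -
      distrOfMeasure (tube G) (tensorMeasure μ.reNeg)) +
    Distribution.mapCLM (ContinuousLinearMap.lsmul ℝ ℂ Complex.I : ℂ →L[ℝ] ℂ)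
      (distrOfMeasure (tube G) (tensorMeasure μ.imPos) -
        distrOfMeasure (tube G) (tensorMeasure μ.imNeg))

end Tube

end

/-! The coefficients do not depend on `x`, so the hypotheses can be tested on products `χ(x) ψ(y)`
with `∫ χ = 1`, where every `x`-derivative integrates to zero. Then `dF = 0` gives the relations
`∂_l F̂_jk = ∂_l F̂_kj` and `∂_l F̂_jk = ∂_j F̂_lk` on `G` (`closed_relations`), and positivity
makes `(F̂_jk)` Hermitian with positive semidefinite real part (`positive_relations`). Hence `F̂_jk
- F̂_kj = 2i Im F̂_jk` has zero gradient, so `Im F̂_jk` is a constant `c_jk` times Lebesgue measure,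
with `c` antisymmetric. The real part is a symmetric positive matrix with totally symmetric first
derivatives, which is the condition for being the Hessian of a convex function. As `∂²/∂z_j∂z̄_k` of
`A(y)` is a quarter of `∂²A/∂y_j∂y_k`, the potential must satisfy `Hess A = 4 Re F̂`; the quadratic
polynomial accounts for the constants `c_jk`.

The work lies in solving `Hess A = 4 Re F̂` for measures. After mollification, on convex open sets
exhausting `G`, the Poincaré lemma applied twice gives smooth convex potentials
(`exists_potential_of_hessian`). They are determined up to affine functions, and the right choice is
to subtract the average over a fixed ball `S` of the tangent planes. What remains is an average of
Taylor remainders: it is nonnegative, and its `L¹` norm on a compact convex set is bounded by the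
`L¹` norm of the Hessian there (`exists_normalized_potential`), hence by the mass of `F̂` nearby.
The mean value inequality for convex functions turns this into local sup bounds, bounded convex
functions are locally equi-Lipschitz, and so an ultrafilter limit exists locally uniformly
(`exists_convex_limit`). Integration by parts identifies its distributional Hessian
(`exists_convex_potential_of_weak_limit`, `exists_potential_of_closed_hermitian`).

Finally `current11_eq_ddc` returns to an arbitrary test function on the tube by applying the
identities on `G` to its slices `y ↦ φ(x + iy)` and integrating in `x`. -/

noncomputable section

/-! ### Coordinate-free formulas for `d`, `d^c`, `dd^c` and (1,1)-currents. -/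

namespace Tube
section FormAlgebra
variable {n : ℕ} {Ω : Opens (Fin n → ℂ)} {k : ℕ}

theorem wedge_apply (α : (Fin n → ℂ) →L[ℝ] ℂ) (ω : Form n k) (v : Fin (k + 1) → Fin n → ℂ) :
    wedge α ω v = ∑ i : Fin (k + 1), (-1) ^ (i : ℕ) * (α (v i) * ω (i.removeNth v)) := by
  simp [wedge, ContinuousAlternatingMap.alternatizeUncurryFin_apply]

theorem dx_apply (j : Fin n) (v : Fin n → ℂ) : dx j v = ((v j).re : ℂ) := rfl

theorem dy_apply (j : Fin n) (v : Fin n → ℂ) : dy j v = ((v j).im : ℂ) := rfl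

theorem dz_apply (j : Fin n) (v : Fin n → ℂ) : dz j v = v j := by
  simp only [dz, _root_.add_apply, _root_.smul_apply, dx_apply, dy_apply,
    smul_eq_mul]
  rw [mul_comm]; exact Complex.re_add_im _

theorem dzbar_apply (j : Fin n) (v : Fin n → ℂ) : dzbar j v = (starRingEnd ℂ) (v j) := by
  simp only [dzbar, _root_.sub_apply, _root_.smul_apply, dx_apply,
    dy_apply, smul_eq_mul]
  apply Complex.ext <;> simp

/-- The derivative of a test function in a constant direction. -/
abbrev tderiv {E : Type*} [NormedAddCommGroup E] [NormedSpace ℝ E] {Ω : Opens E} (v : E)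
    (φ : TestFunction Ω ℝ ⊤) : TestFunction Ω ℝ ⊤ :=
  TestFunction.lineDerivCLM ℝ v φ

theorem tderiv_apply {E : Type*} [NormedAddCommGroup E] [NormedSpace ℝ E] {Ω : Opens E} (v : E)
    (φ : TestFunction Ω ℝ ⊤) (x : E) : tderiv v φ x = fderiv ℝ φ x v := by
  rw [tderiv, TestFunction.lineDerivCLM_eq_fderivCLM,
    TestFunction.fderivCLM_apply_of_le _ (by simp)]

theorem eq_sum_real_directions (v : Fin n → ℂ) :
    v = ∑ j, ((v j).re • (Pi.single j (1 : ℂ) : Fin n → ℂ)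
      + (v j).im • (Pi.single j Complex.I : Fin n → ℂ)) := by
  have h : ∀ j, (v j).re • (Pi.single j (1 : ℂ) : Fin n → ℂ)
      + (v j).im • (Pi.single j Complex.I : Fin n → ℂ) = Pi.single j (v j) := by
    intro j
    rw [← Pi.single_smul, ← Pi.single_smul, ← Pi.single_add]
    congr 1
    simp [Complex.re_add_im]
  simp_rw [h]
  exact (Finset.univ_sum_single v).symm

theorem tderiv_eq_sum (v : Fin n → ℂ) (φ : TestFunction Ω ℝ ⊤) :
    tderiv v φ = ∑ j, ((v j).re • tderiv (Pi.single j (1 : ℂ)) φ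
      + (v j).im • tderiv (Pi.single j Complex.I) φ) := by
  ext x
  simp only [_root_.sum_apply, _root_.add_apply, _root_.smul_apply, tderiv_apply]
  conv_lhs => rw [eq_sum_real_directions v]
  simp only [map_sum, map_add, map_smul]

/-- The sum over the `2n` real coordinates collapses to the derivative of `φ` along `v i`, by
linearity. The global sign comes from moving the derivative onto `φ`. -/
theorem extD_apply (T : Current Ω k) (φ : TestFunction Ω ℝ ⊤) (v : Fin (k + 1) → Fin n → ℂ) :
    extD T φ v = -∑ i : Fin (k + 1), (-1) ^ (i : ℕ) * T (tderiv (v i) φ) (i.removeNth v) := by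
  have h1 : extD T φ v = ∑ j : Fin n, ∑ i : Fin (k + 1), (-1) ^ (i : ℕ) *
      -(((v i j).re : ℂ) * T (tderiv (Pi.single j (1 : ℂ)) φ) (i.removeNth v) +
        ((v i j).im : ℂ) * T (tderiv (Pi.single j Complex.I) φ) (i.removeNth v)) := by
    simp only [extD, wedgeC, pdx, pdy, _root_.sum_apply, ContinuousAlternatingMap.sum_apply,
      ContinuousAlternatingMap.add_apply, ContinuousAlternatingMap.neg_apply, _root_.add_apply,
      Distribution.mapCLM_apply, Distribution.lineDerivCLM_apply, wedge_apply, dx_apply, dy_apply]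
    refine Finset.sum_congr rfl fun j _ => ?_
    rw [← Finset.sum_add_distrib]
    refine Finset.sum_congr rfl fun i _ => ?_
    ring
  rw [h1, Finset.sum_comm, ← Finset.sum_neg_distrib]
  refine Finset.sum_congr rfl fun i _ => ?_
  rw [tderiv_eq_sum (v i) φ]
  simp only [map_sum, map_add, map_smul, ContinuousAlternatingMap.sum_apply,
    ContinuousAlternatingMap.add_apply, ContinuousAlternatingMap.smul_apply,
    Finset.mul_sum, ← Finset.sum_neg_distrib, Complex.real_smul]
  refine Finset.sum_congr rfl fun j _ => ?_
  ring

theorem current0_apply (T : Distr Ω) (φ : TestFunction Ω ℝ ⊤) (v : Fin 0 → Fin n → ℂ) :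
    current0 T φ v = T φ := rfl

/-- For a function, `d^c u (w) = -(1/4) du(iw)`; moving the derivative onto the test function
cancels the sign. -/
theorem extDc_current0_apply (T : Distr Ω) (φ : TestFunction Ω ℝ ⊤) (w : Fin 1 → Fin n → ℂ) :
    extDc (current0 T) φ w = (1 / 4) * T (tderiv (Complex.I • w 0) φ) := by
  rw [tderiv_eq_sum]
  simp only [extDc, del, delbar, pdz, pdzbar, cmul, wedgeC, pdx, pdy, _root_.sum_apply,
    ContinuousAlternatingMap.sum_apply, ContinuousAlternatingMap.add_apply,
    ContinuousAlternatingMap.smul_apply,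
    ContinuousAlternatingMap.sub_apply, ContinuousAlternatingMap.neg_apply,
    _root_.sub_apply, _root_.add_apply, Distribution.mapCLM_apply,
    Distribution.lineDerivCLM_apply, wedge_apply, dz_apply, dzbar_apply,
    map_sum, map_add, map_smul, ContinuousLinearMap.lsmul_apply, smul_eq_mul,
    current0_apply, Complex.real_smul, ← Finset.sum_sub_distrib, Finset.mul_sum]
  refine Finset.sum_congr rfl fun j _ => ?_
  set a := T (tderiv (Pi.single j (1 : ℂ)) φ)
  set b := T (tderiv (Pi.single j Complex.I) φ)
  simp only [Pi.smul_apply, smul_eq_mul, Complex.I_mul_re, Complex.I_mul_im]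
  obtain ⟨p, q, hpq⟩ : ∃ p q : ℝ, w 0 j = p + q * Complex.I := ⟨_, _, (Complex.re_add_im _).symm⟩
  rw [hpq]
  have hI := Complex.I_sq
  simp [hpq]
  field_simp
  ring_nf
  simp [hI]
  ring

theorem ddc_apply (u : (Fin n → ℂ) → ℝ) (φ : TestFunction Ω ℝ ⊤) (v : Fin 2 → Fin n → ℂ) :
    ddc Ω u φ v = (1 / 4) * (distrOfFun Ω u (tderiv (Complex.I • v 0) (tderiv (v 1) φ))
      - distrOfFun Ω u (tderiv (Complex.I • v 1) (tderiv (v 0) φ))) := by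
  rw [ddc, extD_apply]
  simp [Fin.sum_univ_two, extDc_current0_apply, Fin.removeNth]
  ring

theorem current11_apply (Fc : Fin n → Fin n → Distr Ω) (φ : TestFunction Ω ℝ ⊤)
    (v : Fin 2 → Fin n → ℂ) :
    current11 Fc φ v = (Complex.I / 2) * ∑ j, ∑ l, Fc j l φ *
      (v 0 j * (starRingEnd ℂ) (v 1 l) - v 1 j * (starRingEnd ℂ) (v 0 l)) := by
  simp only [current11, cmul, distrForm, Distribution.mapCLM_apply, dzdzbar]
  simp [wedge_apply, dz_apply, dzbar_apply, Fin.sum_univ_two, form0, Fin.removeNth, Finset.mul_sum]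
  refine Finset.sum_congr rfl fun j _ => Finset.sum_congr rfl fun l _ => ?_
  ring

end FormAlgebra
end Tube

/-! ### Potentials of smooth Hessians, Taylor remainders, integration by parts. -/

namespace Tube
section Potential
open Filter Topology Metric Set

variable {E : Type*} [NormedAddCommGroup E] [NormedSpace ℝ E]

/-- The Poincaré lemma is used twice. `hclosed` says that `H`, as a 1-form with values in the dual,
is closed, which gives `g`; symmetry of `H` then says that `g` is closed, which gives `A`. -/
theorem exists_potential_of_hessian {U : Set E} (hU : Convex ℝ U) (hUo : IsOpen U)
    {H : E → E →L[ℝ] E →L[ℝ] ℝ} (hd : DifferentiableOn ℝ H U)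
    (hclosed : ∀ a ∈ U, ∀ x y, fderiv ℝ H a x y = fderiv ℝ H a y x)
    (hsymm : ∀ a ∈ U, ∀ x y, H a x y = H a y x) :
    ∃ (A : E → ℝ) (g : E → E →L[ℝ] ℝ),
      (∀ a ∈ U, HasFDerivAt A (g a) a) ∧ ∀ a ∈ U, HasFDerivAt g (H a) a := by
  obtain ⟨g, hg⟩ := hU.exists_forall_hasFDerivAt_of_fderiv_symmetric hUo hd hclosed
  obtain ⟨A, hA⟩ := hU.exists_forall_hasFDerivAt_of_fderiv_symmetric hUo (ω := g)
    (fun a ha => (hg a ha).differentiableAt.differentiableWithinAt)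
    (fun a ha x y => by rw [(hg a ha).fderiv]; exact hsymm a ha x y)
  exact ⟨A, g, hA, hg⟩

section Taylor

variable {U : Set E} {A : E → ℝ} {g : E → E →L[ℝ] ℝ} {H : E → E →L[ℝ] E →L[ℝ] ℝ}

theorem taylor_remainder_eq_integral (hU : Convex ℝ U)
    (hA : ∀ a ∈ U, HasFDerivAt A (g a) a) (hg : ∀ a ∈ U, HasFDerivAt g (H a) a)
    (hH : ContinuousOn H U) {x y : E} (hx : x ∈ U) (hy : y ∈ U) :
    A y - A x - g x (y - x) =
      ∫ t in (0 : ℝ)..1, (1 - t) * H (x + t • (y - x)) (y - x) (y - x) := by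
  set v := y - x with hv
  have hmem : ∀ t ∈ Icc (0 : ℝ) 1, x + t • v ∈ U := fun t ht =>
    hU.add_smul_sub_mem hx hy ht
  have hline : ∀ t : ℝ, HasDerivAt (fun t : ℝ => x + t • v) v t := fun t => by
    simpa using ((hasDerivAt_id t).smul_const v).const_add x
  have hd : ∀ t ∈ uIcc (0 : ℝ) 1, HasDerivAt
      (fun t => A (x + t • v) + (1 - t) * g (x + t • v) v)
      ((1 - t) * H (x + t • v) v v) t := by
    intro t ht
    rw [uIcc_of_le zero_le_one] at ht
    have h1 : HasDerivAt (fun t => A (x + t • v)) (g (x + t • v) v) t :=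
      (hA _ (hmem t ht)).comp_hasDerivAt t (hline t)
    have h2 : HasDerivAt (fun t => g (x + t • v)) (H (x + t • v) v) t :=
      (hg _ (hmem t ht)).comp_hasDerivAt t (hline t)
    have h3 : HasDerivAt (fun t => g (x + t • v) v) (H (x + t • v) v v) t := by
      simpa using h2.clm_apply (hasDerivAt_const t v)
    have h4 : HasDerivAt (fun t : ℝ => 1 - t) (-1) t := by
      simpa using (hasDerivAt_id t).const_sub 1
    refine (h1.add (h4.mul h3)).congr_deriv ?_
    ring
  have hc : ContinuousOn (fun t : ℝ => (1 - t) * H (x + t • v) v v) (uIcc 0 1) := by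
    rw [uIcc_of_le zero_le_one]
    have : ContinuousOn (fun t : ℝ => H (x + t • v)) (Icc 0 1) :=
      hH.comp (by fun_prop) hmem
    exact (by fun_prop : ContinuousOn (fun t : ℝ => 1 - t) (Icc 0 1)).mul
      ((this.clm_apply continuousOn_const).clm_apply continuousOn_const)
  rw [intervalIntegral.integral_eq_sub_of_hasDerivAt hd hc.intervalIntegrable]
  simp [hv]
  ring

theorem taylor_remainder_nonneg (hU : Convex ℝ U)
    (hA : ∀ a ∈ U, HasFDerivAt A (g a) a) (hg : ∀ a ∈ U, HasFDerivAt g (H a) a)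
    (hH : ContinuousOn H U) (hpos : ∀ a ∈ U, ∀ v, 0 ≤ H a v v)
    {x y : E} (hx : x ∈ U) (hy : y ∈ U) : 0 ≤ A y - A x - g x (y - x) := by
  rw [taylor_remainder_eq_integral hU hA hg hH hx hy]
  refine intervalIntegral.integral_nonneg zero_le_one fun t ht => ?_
  exact mul_nonneg (by linarith [ht.2]) (hpos _ (hU.add_smul_sub_mem hx hy ht) _)

/-- The graph lies above each tangent plane. Taking the plane at `z = a • x + b • y`, the
first-order terms cancel in the weighted sum. -/
theorem convexOn_of_hessian_nonneg (hU : Convex ℝ U)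
    (hA : ∀ a ∈ U, HasFDerivAt A (g a) a) (hg : ∀ a ∈ U, HasFDerivAt g (H a) a)
    (hH : ContinuousOn H U) (hpos : ∀ a ∈ U, ∀ v, 0 ≤ H a v v) : ConvexOn ℝ U A := by
  refine ⟨hU, fun x hx y hy a b ha hb hab => ?_⟩
  have hz := hU hx hy ha hb hab
  set z := a • x + b • y with hzdef
  have h1 := taylor_remainder_nonneg hU hA hg hH hpos hz hx
  have h2 := taylor_remainder_nonneg hU hA hg hH hpos hz hy
  have h3 : a * g z (x - z) + b * g z (y - z) = 0 := by
    rw [← smul_eq_mul, ← smul_eq_mul, ← map_smul, ← map_smul, ← map_add]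
    have : a • (x - z) + b • (y - z) = 0 := by
      rw [smul_sub, smul_sub, sub_add_sub_comm, ← add_smul, hab, one_smul, ← hzdef, sub_self]
    rw [this, map_zero]
  simp only [smul_eq_mul]
  nlinarith [mul_nonneg ha h1, mul_nonneg hb h2, congrArg (· * A z) hab]

theorem taylor_remainder_le (hU : Convex ℝ U)
    (hA : ∀ a ∈ U, HasFDerivAt A (g a) a) (hg : ∀ a ∈ U, HasFDerivAt g (H a) a)
    (hH : ContinuousOn H U) {x y : E} (hx : x ∈ U) (hy : y ∈ U) :
    ENNReal.ofReal (A y - A x - g x (y - x)) ≤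
      ‖y - x‖ₑ ^ 2 * ∫⁻ t in Icc (0 : ℝ) 1, ENNReal.ofReal ‖H (x + t • (y - x))‖ := by
  have hmeas : (volume.restrict (Icc (0 : ℝ) 1)) = volume.restrict (Ioc (0 : ℝ) 1) :=
    Measure.restrict_congr_set Ioc_ae_eq_Icc.symm
  rw [taylor_remainder_eq_integral hU hA hg hH hx hy, hmeas, ← lintegral_const_mul' _ _ (by simp),
    intervalIntegral.integral_of_le zero_le_one]
  refine (ENNReal.ofReal_le_ofReal (le_abs_self _)).trans ?_
  rw [← Real.norm_eq_abs, ofReal_norm]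
  refine (enorm_integral_le_lintegral_enorm _).trans ?_
  refine setLIntegral_mono' measurableSet_Ioc fun t ht => ?_
  have h1 : ‖(1 - t) * H (x + t • (y - x)) (y - x) (y - x)‖ ≤
      ‖y - x‖ ^ 2 * ‖H (x + t • (y - x))‖ := by
    rw [norm_mul]
    have h2 : ‖1 - t‖ ≤ 1 := by
      rw [Real.norm_eq_abs, abs_le]; constructor <;> linarith [ht.1, ht.2]
    calc ‖1 - t‖ * ‖H (x + t • (y - x)) (y - x) (y - x)‖
        ≤ 1 * (‖H (x + t • (y - x))‖ * ‖y - x‖ * ‖y - x‖) :=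
          mul_le_mul h2 (ContinuousLinearMap.le_opNorm₂ _ _ _) (norm_nonneg _) zero_le_one
      _ = _ := by ring
  have := ENNReal.ofReal_le_ofReal h1
  rw [ENNReal.ofReal_mul (by positivity), ENNReal.ofReal_pow (norm_nonneg _)] at this
  simpa only [ofReal_norm] using this

end Taylor

section IntegrationByParts

variable [FiniteDimensional ℝ E] [MeasurableSpace E] [BorelSpace E] {μ : Measure E}
  [μ.IsAddHaarMeasure]

theorem integrable_mul_of_tsupport_subset {ν : Measure E} [IsFiniteMeasureOnCompacts ν]
    {U : Set E} {f ψ : E → ℝ} (hf : ContinuousOn f U)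
    (hψ : Continuous ψ) (hc : HasCompactSupport ψ) (hs : tsupport ψ ⊆ U) :
    Integrable (fun x => f x * ψ x) ν := by
  have h1 : IntegrableOn (fun x => f x * ψ x) (tsupport ψ) ν :=
    ((hf.mono hs).mul hψ.continuousOn).integrableOn_compact hc
  exact (integrableOn_iff_integrable_of_support_subset
    ((Function.support_mul_subset_right _ _).trans (subset_tsupport ψ))).1 h1

theorem integral_mul_fderiv_eq {U : Set E} {A : E → ℝ} {g : E → E →L[ℝ] ℝ}
    (hA : ∀ a ∈ U, HasFDerivAt A (g a) a) (hg : ContinuousOn g U)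
    {ψ : E → ℝ} (hψ : ContDiff ℝ 1 ψ) (hc : HasCompactSupport ψ)
    (hs : tsupport ψ ⊆ U) (v : E) :
    ∫ x, A x * fderiv ℝ ψ x v ∂μ = -∫ x, g x v * ψ x ∂μ := by
  have hAc : ContinuousOn A U := fun a ha => (hA a ha).continuousAt.continuousWithinAt
  have hts : tsupport (fun x => fderiv ℝ ψ x v) ⊆ tsupport ψ :=
    (tsupport_fderiv_apply_subset ℝ v)
  refine integral_bilinear_hasFDerivAt_right_eq_neg_left_of_integrable
    (B := ContinuousLinearMap.mul ℝ ℝ) (f' := g) (g' := fderiv ℝ ψ) ?_ ?_ ?_ 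
    (fun x hx => hA x (hs hx)) (fun x _ => (hψ.differentiable one_ne_zero x).hasFDerivAt)
  · exact integrable_mul_of_tsupport_subset (hg.clm_apply continuousOn_const) hψ.continuous hc hs
  · exact integrable_mul_of_tsupport_subset hAc
      ((hψ.continuous_fderiv one_ne_zero).clm_apply continuous_const)
      (hc.fderiv_apply ℝ v) (hts.trans hs)
  · exact integrable_mul_of_tsupport_subset hAc hψ.continuous hc hs

/-- The pointwise Hessian is the distributional one. Only the support of `ψ` has to lie in `U`, so
`A` may be arbitrary outside. -/
theorem integral_mul_fderiv_fderiv_eq {U : Set E} {A : E → ℝ}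
    {g : E → E →L[ℝ] ℝ} {H : E → E →L[ℝ] E →L[ℝ] ℝ}
    (hA : ∀ a ∈ U, HasFDerivAt A (g a) a) (hg : ∀ a ∈ U, HasFDerivAt g (H a) a)
    (hH : ContinuousOn H U) {ψ : E → ℝ} (hψ : ContDiff ℝ 2 ψ) (hc : HasCompactSupport ψ)
    (hs : tsupport ψ ⊆ U) (v w : E) :
    ∫ x, A x * fderiv ℝ (fun y => fderiv ℝ ψ y w) x v ∂μ = ∫ x, H x w v * ψ x ∂μ := by
  have hgc : ContinuousOn g U := fun a ha => (hg a ha).continuousAt.continuousWithinAt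
  have hg' : ∀ a ∈ U, HasFDerivAt (fun x => g x v) ((H a).flip v) a := fun a ha => by
    refine ((hg a ha).clm_apply (hasFDerivAt_const v a)).congr_fderiv ?_
    ext; simp
  rw [integral_mul_fderiv_eq hA hgc ((hψ.fderiv_right (m := 1) (by norm_num)).clm_apply
    contDiff_const) (hc.fderiv_apply ℝ w) ((tsupport_fderiv_apply_subset ℝ w).trans hs),
    integral_mul_fderiv_eq hg' ?_ (hψ.of_le (by norm_num)) hc hs, neg_neg]
  · rfl
  · exact (ContinuousLinearMap.flipₗᵢ ℝ E E ℝ).continuous.comp_continuousOn hH |>.clm_apply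
      continuousOn_const

end IntegrationByParts
end Potential
end Tube

/-! ### A priori bounds for normalized convex potentials. -/

namespace Tube
section AprioriBound
open Filter Topology Metric Set

variable {E : Type*} [NormedAddCommGroup E] [NormedSpace ℝ E] [FiniteDimensional ℝ E]
  [MeasurableSpace E] [BorelSpace E] {μ : Measure E} [μ.IsAddHaarMeasure]

theorem lintegral_comp_smul_add_le {h : E → ENNReal} (hh : Measurable h) {s : ℝ}
    (hs : 1 / 2 ≤ s) (c : E) :
    ∫⁻ x, h (s • x + c) ∂μ ≤ 2 ^ Module.finrank ℝ E * ∫⁻ x, h x ∂μ := by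
  have hs0 : 0 < s := by linarith
  have h1 : ∫⁻ x, h (s • x + c) ∂μ = ∫⁻ x, h (x + c) ∂(μ.map (fun x => s • x)) :=
    (lintegral_map (f := fun x => h (x + c)) (by fun_prop) (measurable_const_smul s)).symm
  rw [h1, Measure.map_addHaar_smul μ hs0.ne', lintegral_smul_measure,
    lintegral_add_right_eq_self, smul_eq_mul]
  gcongr
  rw [abs_of_pos (by positivity), ← ENNReal.ofReal_ofNat, ← ENNReal.ofReal_pow (by norm_num),
    ← inv_pow]
  refine ENNReal.ofReal_le_ofReal ?_
  gcongr
  rw [inv_le_comm₀ hs0 (by norm_num)]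
  simpa using hs

/-- The point is `(1 - t) x + t y`, and one of the two weights is at least `1/2`. Changing variables
in that one costs a Jacobian of at most `2 ^ dim`, so the bound is uniform up to both ends of `[0,
1]`. -/
theorem lintegral_lintegral_segment_le {h : E → ENNReal} (hh : Measurable h) (S T : Set E)
    {t : ℝ} (ht : t ∈ Icc (0 : ℝ) 1) :
    ∫⁻ y in T, ∫⁻ x in S, h (x + t • (y - x)) ∂μ ∂μ ≤
      2 ^ Module.finrank ℝ E * (μ S + μ T) * ∫⁻ x, h x ∂μ := by
  have hm : Measurable (fun p : E × E => h (p.2 + t • (p.1 - p.2))) :=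
    hh.comp (by fun_prop)
  rcases le_total t (1 / 2) with h2 | h2
  · calc ∫⁻ y in T, ∫⁻ x in S, h (x + t • (y - x)) ∂μ ∂μ
        ≤ ∫⁻ _ in T, 2 ^ Module.finrank ℝ E * ∫⁻ x, h x ∂μ ∂μ := by
          refine lintegral_mono fun y => ?_
          refine (setLIntegral_le_lintegral _ _).trans ?_
          refine le_trans (le_of_eq ?_)
            (lintegral_comp_smul_add_le hh (s := 1 - t) (by linarith) (t • y))
          refine lintegral_congr fun x => ?_
          congr 1; module
      _ = (2 ^ Module.finrank ℝ E * ∫⁻ x, h x ∂μ) * μ T := setLIntegral_const _ _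
      _ ≤ _ := by
          rw [mul_right_comm]
          gcongr
          exact le_add_self
  · rw [lintegral_lintegral_swap hm.aemeasurable]
    calc ∫⁻ x in S, ∫⁻ y in T, h (x + t • (y - x)) ∂μ ∂μ
        ≤ ∫⁻ _ in S, 2 ^ Module.finrank ℝ E * ∫⁻ x, h x ∂μ ∂μ := by
          refine lintegral_mono fun x => ?_
          refine (setLIntegral_le_lintegral _ _).trans ?_
          refine le_trans (le_of_eq ?_)
            (lintegral_comp_smul_add_le hh (s := t) h2 ((1 - t) • x))
          refine lintegral_congr fun y => ?_
          congr 1; module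
      _ = (2 ^ Module.finrank ℝ E * ∫⁻ x, h x ∂μ) * μ S := setLIntegral_const _ _
      _ ≤ _ := by
          rw [mul_right_comm]
          gcongr
          exact le_self_add

/-- Tonelli moves the segment parameter `t` outside in the integrated Taylor bound, and the estimate
uniform in `t` applies inside. -/
theorem lintegral_taylor_remainder_le {U K S : Set E} {A : E → ℝ} {g : E → E →L[ℝ] ℝ}
    {H : E → E →L[ℝ] E →L[ℝ] ℝ} (hU : Convex ℝ U)
    (hA : ∀ a ∈ U, HasFDerivAt A (g a) a) (hg : ∀ a ∈ U, HasFDerivAt g (H a) a)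
    (hH : ContinuousOn H U) (hK : IsCompact K) (hKc : Convex ℝ K) (hKU : K ⊆ U) (hS : S ⊆ K)
    (hSm : MeasurableSet S) {D : ENNReal} (hD : ∀ x ∈ K, ∀ y ∈ K, ‖y - x‖ₑ ≤ D) :
    ∫⁻ y in K, ∫⁻ x in S, ENNReal.ofReal (A y - A x - g x (y - x)) ∂μ ∂μ ≤
      D ^ 2 * (2 ^ Module.finrank ℝ E * (μ S + μ K) *
        ∫⁻ x in K, ENNReal.ofReal ‖H x‖ ∂μ) := by
  have hKm := hK.measurableSet
  -- Extending by zero off `K` makes the function globally measurable and allows changes of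
  -- variables on all of `E`. Nothing is lost on the segments, which stay in `K` by convexity.
  set h : E → ENNReal := K.indicator fun x => ENNReal.ofReal ‖H x‖ with hh
  have hmeas : Measurable h := by
    have : h = fun x => ENNReal.ofReal (K.indicator (fun x => ‖H x‖) x) := by
      ext x; by_cases hx : x ∈ K <;> simp [hh, hx]
    rw [this]
    refine ENNReal.measurable_ofReal.comp ?_
    have hc : ContinuousOn (fun x => ‖H x‖) K := 
      (continuous_norm (E := E →L[ℝ] E →L[ℝ] ℝ)).comp_continuousOn (hH.mono hKU)
    classical
    exact (hc.measurable_piecewise (g := fun _ => (0 : ℝ)) continuousOn_const hKm)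
  have hm3 : Measurable (fun q : ℝ × E × E => h (q.2.2 + q.1 • (q.2.1 - q.2.2))) :=
    hmeas.comp (by fun_prop)
  have hm3' : Measurable (fun q : (E × E) × ℝ => h (q.1.2 + q.2 • (q.1.1 - q.1.2))) :=
    hmeas.comp (by fun_prop)
  calc ∫⁻ y in K, ∫⁻ x in S, ENNReal.ofReal (A y - A x - g x (y - x)) ∂μ ∂μ
      ≤ ∫⁻ y in K, ∫⁻ x in S,
          D ^ 2 * (∫⁻ t in Icc (0 : ℝ) 1, h (x + t • (y - x))) ∂μ ∂μ := by
        refine setLIntegral_mono' hKm fun y hy => setLIntegral_mono' hSm fun x hx => ?_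
        refine (taylor_remainder_le hU hA hg hH (hKU (hS hx)) (hKU hy)).trans ?_
        refine mul_le_mul' (pow_le_pow_left' (hD _ (hS hx) _ hy) 2) ?_
        · refine setLIntegral_mono' measurableSet_Icc fun t ht => ?_
          rw [hh, indicator_of_mem (hKc.add_smul_sub_mem (hS hx) hy ht)]
    _ = D ^ 2 * ∫⁻ p : E × E, (∫⁻ t in Icc (0 : ℝ) 1, h (p.2 + t • (p.1 - p.2)))
          ∂((μ.restrict K).prod (μ.restrict S)) := by
        have hm2 : Measurable fun p : E × E => ∫⁻ t in Icc (0 : ℝ) 1, h (p.2 + t • (p.1 - p.2)) :=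
          hm3'.lintegral_prod_right'
        rw [← lintegral_const_mul _ hm2, lintegral_prod _ (hm2.const_mul _).aemeasurable]
    _ = D ^ 2 * ∫⁻ t in Icc (0 : ℝ) 1, ∫⁻ p : E × E, h (p.2 + t • (p.1 - p.2))
          ∂((μ.restrict K).prod (μ.restrict S)) := by
        rw [lintegral_lintegral_swap hm3'.aemeasurable]
    _ ≤ D ^ 2 * ∫⁻ t in Icc (0 : ℝ) 1, 2 ^ Module.finrank ℝ E * (μ S + μ K) * ∫⁻ x, h x ∂μ := by
        gcongr 1
        refine setLIntegral_mono' measurableSet_Icc fun t ht => ?_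
        rw [lintegral_prod (fun p : E × E => h (p.2 + t • (p.1 - p.2)))
          (hmeas.comp (by fun_prop)).aemeasurable]
        exact lintegral_lintegral_segment_le hmeas S K ht
    _ = _ := by
        rw [setLIntegral_const, hh, lintegral_indicator hKm]
        simp

/-- Any two potentials differ by an affine function, so a normalization is needed before a bound can
hold. Subtracting the `S`-average of the tangent planes leaves the `S`-average of the Taylor
remainders, which is nonnegative and controlled in `L¹` by the Hessian. -/
theorem exists_normalized_potential {U : Set E} (hU : Convex ℝ U) (hUo : IsOpen U)
    {H : E → E →L[ℝ] E →L[ℝ] ℝ} (hd : DifferentiableOn ℝ H U)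
    (hclosed : ∀ a ∈ U, ∀ x y, fderiv ℝ H a x y = fderiv ℝ H a y x)
    (hsymm : ∀ a ∈ U, ∀ x y, H a x y = H a y x) (hpos : ∀ a ∈ U, ∀ v, 0 ≤ H a v v)
    {S : Set E} (hS : IsCompact S) (hSU : S ⊆ U) (hS0 : μ S ≠ 0) :
    ∃ (A : E → ℝ) (g : E → E →L[ℝ] ℝ),
      (∀ a ∈ U, HasFDerivAt A (g a) a) ∧ (∀ a ∈ U, HasFDerivAt g (H a) a) ∧
      (∀ a ∈ U, 0 ≤ A a) ∧ ConvexOn ℝ U A ∧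
      ∀ K : Set E, IsCompact K → Convex ℝ K → S ⊆ K → K ⊆ U → ∀ D : ENNReal,
        (∀ x ∈ K, ∀ y ∈ K, ‖y - x‖ₑ ≤ D) →
        μ S * ∫⁻ y in K, ENNReal.ofReal (A y) ∂μ ≤ D ^ 2 * (2 ^ Module.finrank ℝ E * (μ S + μ K) *
          ∫⁻ x in K, ENNReal.ofReal ‖H x‖ ∂μ) := by
  obtain ⟨A, g, hA, hg⟩ := exists_potential_of_hessian hU hUo hd hclosed hsymm
  have hH : ContinuousOn H U := hd.continuousOn
  have hgc : ContinuousOn g U := fun a ha => (hg a ha).continuousAt.continuousWithinAt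
  have hAc : ContinuousOn A U := fun a ha => (hA a ha).continuousAt.continuousWithinAt
  have hS1 : μ S ≠ ⊤ := hS.measure_lt_top.ne
  have : IsFiniteMeasure (μ.restrict S) := isFiniteMeasure_restrict.2 hS1
  have hSr : 0 < μ.real S := ENNReal.toReal_pos hS0 hS1
  -- The averaged tangent plane is `y ↦ a₀ + ℓ y`.
  set a₀ : ℝ := (μ.real S)⁻¹ * ∫ x in S, (A x - g x x) ∂μ
  set ℓ : E →L[ℝ] ℝ := (μ.real S)⁻¹ • ∫ x in S, g x ∂μ
  have hi1 : IntegrableOn (fun x => A x - g x x) S μ :=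
    ((hAc.mono hSU).sub ((hgc.mono hSU).clm_apply continuousOn_id)).integrableOn_compact hS
  have hi2 : IntegrableOn g S μ := (hgc.mono hSU).integrableOn_compact hS
  have hi3 : ∀ y, IntegrableOn (fun x => g x y) S μ := fun y =>
    ((hgc.mono hSU).clm_apply continuousOn_const).integrableOn_compact hS
  have hiR : ∀ y, IntegrableOn (fun x => A y - A x - g x (y - x)) S μ := fun y =>
    ((continuousOn_const.sub (hAc.mono hSU)).sub ((hgc.mono hSU).clm_apply
      (continuousOn_const.sub continuousOn_id))).integrableOn_compact hS
  have key : ∀ y, μ.real S * (A y - a₀ - ℓ y) = ∫ x in S, (A y - A x - g x (y - x)) ∂μ := by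
    intro y
    have e : ∀ x, A y - A x - g x (y - x) = A y - (A x - g x x) - g x y := fun x => by
      rw [map_sub]; ring
    simp_rw [e]
    have hs : Integrable (fun x => A y - (A x - g x x)) (μ.restrict S) :=
      (integrable_const (A y)).sub hi1
    rw [integral_sub hs (hi3 y),
      integral_sub (integrable_const (A y)) hi1, setIntegral_const,
      ← ContinuousLinearMap.integral_apply hi2]
    simp only [a₀, ℓ, _root_.smul_apply, smul_eq_mul]
    field_simp
  have hRnn : ∀ y ∈ U, ∀ x ∈ S, 0 ≤ A y - A x - g x (y - x) := fun y hy x hx =>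
    taylor_remainder_nonneg hU hA hg hH hpos (hSU hx) hy
  have hA' : ∀ a ∈ U, HasFDerivAt (fun y => A y - a₀ - ℓ y) (g a - ℓ) a := fun a ha =>
    ((hA a ha).sub_const a₀).sub ℓ.hasFDerivAt
  have hg' : ∀ a ∈ U, HasFDerivAt (fun y => g y - ℓ) (H a) a := fun a ha =>
    (hg a ha).sub_const ℓ
  refine ⟨fun y => A y - a₀ - ℓ y, fun y => g y - ℓ, hA', hg', fun y hy => ?_,
    convexOn_of_hessian_nonneg hU hA' hg' hH hpos, fun K hK hKc hSK hKU D hD => ?_⟩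
  · have : 0 ≤ μ.real S * (A y - a₀ - ℓ y) := by
      rw [key]
      exact setIntegral_nonneg hS.measurableSet (hRnn y hy)
    exact nonneg_of_mul_nonneg_right this hSr
  · refine le_trans (le_of_eq ?_) (lintegral_taylor_remainder_le hU hA hg hH hK hKc hKU hSK
      hS.measurableSet hD)
    rw [← lintegral_const_mul' _ _ hS1]
    refine setLIntegral_congr_fun hK.measurableSet fun y hy => ?_
    dsimp only
    rw [← ENNReal.ofReal_toReal hS1, ← ENNReal.ofReal_mul ENNReal.toReal_nonneg,
      ← ofReal_integral_eq_lintegral_ofReal (hiR y)]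
    · rw [← key]; rfl
    · exact ae_restrict_of_forall_mem hS.measurableSet (hRnn y (hKU hy))

/-- The mean value inequality: average `2 f(y) ≤ f(x) + f(2y - x)` over the ball, which the
reflection `x ↦ 2y - x` maps to itself preserving the measure. -/
theorem convexOn_mul_measure_closedBall_le_lintegral {f : E → ℝ} {y : E} {s : ℝ}
    (hf : ConvexOn ℝ (closedBall y s) f) (hfc : ContinuousOn f (closedBall y s))
    (hf0 : ∀ x ∈ closedBall y s, 0 ≤ f x) :
    ENNReal.ofReal (f y) * μ (closedBall y s) ≤
      ∫⁻ x in closedBall y s, ENNReal.ofReal (f x) ∂μ := by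
  set B := closedBall y s
  have hBm : MeasurableSet B := measurableSet_closedBall
  have hrefl : ∀ x ∈ B, y + y - x ∈ B := fun x hx => by
    rw [mem_closedBall, dist_eq_norm] at hx ⊢
    rwa [show y + y - x - y = -(x - y) by abel, norm_neg]
  have hmp : MeasurePreserving (fun x => y + y - x) μ μ := Measure.measurePreserving_sub_left μ _
  have hpre : (fun x => y + y - x) ⁻¹' B = B := by
    ext x
    refine ⟨fun h => ?_, hrefl x⟩
    simpa using hrefl _ h
  have hsymm : ∫⁻ x in B, ENNReal.ofReal (f (y + y - x)) ∂μ = ∫⁻ x in B, ENNReal.ofReal (f x) ∂μ := by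
    have := hmp.setLIntegral_comp_preimage_emb
      (Homeomorph.subLeft (y + y)).measurableEmbedding (fun x => ENNReal.ofReal (f x)) B
    rwa [hpre] at this
  have h2 : 2 * (ENNReal.ofReal (f y) * μ B) ≤ 2 * ∫⁻ x in B, ENNReal.ofReal (f x) ∂μ := by
    calc 2 * (ENNReal.ofReal (f y) * μ B) = ∫⁻ _ in B, 2 * ENNReal.ofReal (f y) ∂μ := by
          rw [setLIntegral_const, mul_assoc]
      _ ≤ ∫⁻ x in B, (ENNReal.ofReal (f x) + ENNReal.ofReal (f (y + y - x))) ∂μ := by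
          refine setLIntegral_mono' hBm fun x hx => ?_
          rw [← ENNReal.ofReal_add (hf0 x hx) (hf0 _ (hrefl x hx)), ← ENNReal.ofReal_ofNat,
            ← ENNReal.ofReal_mul (by norm_num)]
          refine ENNReal.ofReal_le_ofReal ?_
          have := hf.2 hx (hrefl x hx) (show (0 : ℝ) ≤ 1 / 2 by norm_num)
            (show (0 : ℝ) ≤ 1 / 2 by norm_num) (by norm_num)
          rw [show (1 / 2 : ℝ) • x + (1 / 2 : ℝ) • (y + y - x) = y by module] at this
          simp only [smul_eq_mul] at this
          linarith
      _ = _ := by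
          rw [lintegral_add_left', hsymm, two_mul]
          exact (hfc.aemeasurable hBm).ennreal_ofReal
  exact (ENNReal.mul_le_mul_iff_right (by norm_num) (by norm_num)).1 h2

end AprioriBound
end Tube

/-! ### Compactness: limits of convex functions and of their Hessians. -/

namespace Tube
section WeakLimit
open Filter Topology Metric Set

variable {E : Type*} [NormedAddCommGroup E] [NormedSpace ℝ E] [FiniteDimensional ℝ E]
  [MeasurableSpace E] [BorelSpace E] {μ : Measure E} [μ.IsAddHaarMeasure]

theorem tendsto_integral_mul_of_tendstoUniformlyOn {ι : Type*} {l : Filter ι}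
    {F : ι → E → ℝ} {f θ : E → ℝ} (hθ : Continuous θ) (hc : HasCompactSupport θ)
    (hF : ∀ᶠ i in l, ContinuousOn (F i) (tsupport θ)) (hf : ContinuousOn f (tsupport θ))
    (hu : TendstoUniformlyOn F f l (tsupport θ)) :
    Tendsto (fun i => ∫ x, F i x * θ x ∂μ) l (𝓝 (∫ x, f x * θ x ∂μ)) := by
  have hθi : Integrable (fun x => ‖θ x‖) μ := (hθ.integrable_of_hasCompactSupport hc).norm
  set I := ∫ x, ‖θ x‖ ∂μ with hI
  have hI0 : 0 ≤ I := integral_nonneg fun x => norm_nonneg _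
  rw [Metric.tendsto_nhds]
  intro ε hε
  rw [Metric.tendstoUniformlyOn_iff] at hu
  filter_upwards [hF, hu (ε / (I + 1)) (by positivity)] with i hFi hi
  have h1 : Integrable (fun x => F i x * θ x) μ :=
    integrable_mul_of_tsupport_subset hFi hθ hc subset_rfl
  have h2 : Integrable (fun x => f x * θ x) μ :=
    integrable_mul_of_tsupport_subset hf hθ hc subset_rfl
  rw [dist_eq_norm, ← integral_sub h1 h2]
  calc ‖∫ x, (F i x * θ x - f x * θ x) ∂μ‖ ≤ ∫ x, ε / (I + 1) * ‖θ x‖ ∂μ := by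
        refine norm_integral_le_of_norm_le (hθi.const_mul _) (ae_of_all _ fun x => ?_)
        by_cases hx : x ∈ tsupport θ
        · rw [← sub_mul, norm_mul]
          gcongr
          have := (hi x hx).le
          rwa [dist_comm, dist_eq_norm] at this
        · simp [image_eq_zero_of_notMem_tsupport hx]
    _ = ε / (I + 1) * I := by rw [integral_const_mul]
    _ < ε := by
        rw [div_mul_eq_mul_div, div_lt_iff₀ (by positivity)]
        nlinarith

theorem exists_tendsto_of_eventually_mem_Icc {ι : Type*} (𝓤 : Ultrafilter ι) {a : ι → ℝ} {M : ℝ}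
    (h : ∀ᶠ i in (𝓤 : Filter ι), a i ∈ Icc 0 M) : ∃ b, Tendsto a 𝓤 (𝓝 b) := by
  obtain ⟨b, -, hb⟩ := isCompact_Icc.ultrafilter_le_nhds (𝓤.map a) (by
    rw [le_principal_iff]; exact h)
  exact ⟨b, hb⟩

theorem isCompact_convexJoin {S T : Set E} (hS : IsCompact S) (hT : IsCompact T) :
    IsCompact (convexJoin ℝ S T) := by
  have : convexJoin ℝ S T =
      (fun p : (E × E) × ℝ => AffineMap.lineMap p.1.1 p.1.2 p.2) '' ((S ×ˢ T) ×ˢ Icc (0 : ℝ) 1) := by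
    ext x
    simp only [mem_convexJoin, segment_eq_image_lineMap, mem_image, mem_prod, Prod.exists]
    constructor
    · rintro ⟨a, ha, b, hb, t, ht, rfl⟩
      exact ⟨a, b, t, ⟨⟨ha, hb⟩, ht⟩, rfl⟩
    · rintro ⟨a, b, t, ⟨⟨ha, hb⟩, ht⟩, rfl⟩
      exact ⟨a, ha, b, hb, t, ht, rfl⟩
  rw [this]
  refine ((hS.prod hT).prod isCompact_Icc).image ?_
  simp only [AffineMap.lineMap_apply_module]
  fun_prop

/-- Functions that are nonnegative, convex and locally bounded, uniformly along an ultrafilter, have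
a convex limit along it, locally uniformly. -/
theorem exists_convex_limit {ι : Type*} (𝓤 : Ultrafilter ι) {G : Set E} (hG : IsOpen G)
    (hGc : Convex ℝ G) {F : ι → E → ℝ}
    (hF : ∀ y ∈ G, ∃ s > 0, ∃ M : ℝ, ∀ᶠ i in (𝓤 : Filter ι), ConvexOn ℝ (ball y s) (F i) ∧
      ∀ x ∈ ball y s, F i x ∈ Icc 0 M)
    (hconv : ∀ x ∈ G, ∀ y ∈ G, ∀ᶠ i in (𝓤 : Filter ι), ConvexOn ℝ (segment ℝ x y) (F i)) :
    ∃ f : E → ℝ, ConvexOn ℝ G f ∧ TendstoLocallyUniformlyOn F f 𝓤 G := by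
  have hlim : ∀ y, ∃ b, y ∈ G → Tendsto (fun i => F i y) 𝓤 (𝓝 b) := by
    intro y
    by_cases hy : y ∈ G
    · obtain ⟨s, hs, M, h⟩ := hF y hy
      obtain ⟨b, hb⟩ := exists_tendsto_of_eventually_mem_Icc 𝓤 (a := fun i => F i y) (M := M)
        (h.mono fun i hi => hi.2 y (mem_ball_self hs))
      exact ⟨b, fun _ => hb⟩
    · exact ⟨0, fun h => absurd h hy⟩
  choose f hf using hlim
  refine ⟨f, ⟨hGc, fun x hx y hy a b ha hb hab => ?_⟩, ?_⟩
  · refine le_of_tendsto_of_tendsto (hf _ (hGc hx hy ha hb hab))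
      (((hf x hx).const_mul a).add ((hf y hy).const_mul b)) ?_
    filter_upwards [hconv x hx y hy] with i hi
    exact hi.2 (left_mem_segment ℝ x y) (right_mem_segment ℝ x y) ha hb hab
  · rw [Metric.tendstoLocallyUniformlyOn_iff]
    intro ε hε y hy
    obtain ⟨s, hs, M, h⟩ := hF y hy
    obtain ⟨δ, hδ, hδG⟩ := Metric.isOpen_iff.1 hG y hy
    set L := (2 * M / (s / 2)).toNNReal
    -- A convex function with values in `[0, M]` on a ball is Lipschitz on a smaller concentric
    -- ball, with a constant depending only on `M` and the loss of radius `s / 2`.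
    have hL : ∀ᶠ i in (𝓤 : Filter ι), LipschitzOnWith L (F i) (ball y (s - s / 2)) := by
      filter_upwards [h] with i hi
      refine hi.1.lipschitzOnWith_of_abs_le (half_pos hs) fun x hx => ?_
      rw [abs_of_nonneg (hi.2 x hx).1]
      exact (hi.2 x hx).2
    -- Within distance `r` of `y`, points lie in the Lipschitz ball and in `G`, and the functions
    -- vary by at most `ε / 3`. The `+ 1` covers the case `L = 0`.
    set r := min (min (s / 2) δ) (ε / (3 * (L + 1))) with hr
    have hr0 : 0 < r := by positivity
    have hys : y ∈ ball y (s - s / 2) := mem_ball_self (by linarith)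
    have hrs : ∀ x ∈ ball y r, x ∈ ball y (s - s / 2) ∧ x ∈ G ∧ L * dist x y ≤ ε / 3 := by
      intro x hx
      rw [mem_ball] at hx
      refine ⟨?_, hδG ?_, ?_⟩
      · rw [mem_ball]
        have : r ≤ s / 2 := (min_le_left _ _).trans (min_le_left _ _)
        linarith
      · rw [mem_ball]
        exact hx.trans_le ((min_le_left _ _).trans (min_le_right _ _))
      · have h1 : dist x y ≤ ε / (3 * (L + 1)) := hx.le.trans (min_le_right _ _)
        calc L * dist x y ≤ (L + 1) * (ε / (3 * (L + 1))) := by gcongr; linarith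
          _ = ε / 3 := by field_simp
    have hfL : ∀ x ∈ ball y r, dist (f x) (f y) ≤ ε / 3 := by
      intro x hx
      obtain ⟨h1, h2, h3⟩ := hrs x hx
      refine le_of_tendsto ((hf x h2).dist (hf y hy)) ?_
      filter_upwards [hL] with i hi
      exact (hi.dist_le_mul _ h1 _ hys).trans h3
    refine ⟨ball y r, mem_nhdsWithin_of_mem_nhds (ball_mem_nhds y hr0), ?_⟩
    filter_upwards [hL, (Metric.tendsto_nhds.1 (hf y hy)) (ε / 3) (by positivity)] with i hi hi2
    intro x hx
    obtain ⟨h1, h2, h3⟩ := hrs x hx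
    calc dist (f x) (F i x) ≤ dist (f x) (f y) + dist (f y) (F i y) + dist (F i y) (F i x) :=
          dist_triangle4 _ _ _ _
      _ < ε / 3 + ε / 3 + ε / 3 := by
          have := hfL x hx
          rw [dist_comm] at hi2
          have := (hi.dist_le_mul _ h1 _ hys).trans h3
          rw [dist_comm] at this
          linarith
      _ = ε := by ring

/-- The domains `U m` grow to exhaust `G`, and the Hessians are bounded only in `L¹` on compact
sets. An ultrafilter replaces the extraction of subsequences. -/
theorem exists_convex_potential_of_weak_limit {G : Set E} (hG : IsOpen G) (hGc : Convex ℝ G)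
    (hGne : G.Nonempty) {U : ℕ → Set E} (hU : ∀ m, Convex ℝ (U m)) (hUo : ∀ m, IsOpen (U m))
    (hex : ∀ K ⊆ G, IsCompact K → ∀ᶠ m in atTop, K ⊆ U m)
    {H : ℕ → E → E →L[ℝ] E →L[ℝ] ℝ} (hd : ∀ m, DifferentiableOn ℝ (H m) (U m))
    (hclosed : ∀ m, ∀ a ∈ U m, ∀ x y, fderiv ℝ (H m) a x y = fderiv ℝ (H m) a y x)
    (hsymm : ∀ m, ∀ a ∈ U m, ∀ x y, H m a x y = H m a y x)
    (hpos : ∀ m, ∀ a ∈ U m, ∀ v, 0 ≤ H m a v v)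
    (hbd : ∀ K ⊆ G, IsCompact K → ∃ C : ENNReal, C ≠ ⊤ ∧
      ∀ᶠ m in atTop, ∫⁻ x in K, ENNReal.ofReal ‖H m x‖ ∂μ ≤ C) :
    ∃ A : E → ℝ, ConvexOn ℝ G A ∧ ∀ ψ : E → ℝ, ContDiff ℝ 2 ψ → HasCompactSupport ψ →
      tsupport ψ ⊆ G → ∀ v w, Tendsto (fun m => ∫ x, H m x w v * ψ x ∂μ) (hyperfilter ℕ)
        (𝓝 (∫ x, A x * fderiv ℝ (fun y => fderiv ℝ ψ y w) x v ∂μ)) := by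
  have hle : (hyperfilter ℕ : Filter ℕ) ≤ atTop := Nat.hyperfilter_le_atTop
  obtain ⟨y₀, hy₀⟩ := hGne
  obtain ⟨r, hr, hrG⟩ := nhds_basis_closedBall.mem_iff.1 (hG.mem_nhds hy₀)
  set S := closedBall y₀ r
  have hSc : IsCompact S := isCompact_closedBall _ _
  have hS0 : μ S ≠ 0 := (measure_closedBall_pos μ y₀ hr).ne'
  have hpot : ∀ m, ∃ (A : E → ℝ) (g : E → E →L[ℝ] ℝ), S ⊆ U m →
      (∀ a ∈ U m, HasFDerivAt A (g a) a) ∧ (∀ a ∈ U m, HasFDerivAt g (H m a) a) ∧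
      (∀ a ∈ U m, 0 ≤ A a) ∧ ConvexOn ℝ (U m) A ∧
      ∀ K : Set E, IsCompact K → Convex ℝ K → S ⊆ K → K ⊆ U m → ∀ D : ENNReal,
        (∀ x ∈ K, ∀ y ∈ K, ‖y - x‖ₑ ≤ D) →
        μ S * ∫⁻ y in K, ENNReal.ofReal (A y) ∂μ ≤ D ^ 2 * (2 ^ Module.finrank ℝ E * (μ S + μ K) *
          ∫⁻ x in K, ENNReal.ofReal ‖H m x‖ ∂μ) := by
    intro m
    by_cases hm : S ⊆ U m
    · obtain ⟨A, g, h⟩ := exists_normalized_potential (μ := μ) (hU m) (hUo m) (hd m) (hclosed m)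
        (hsymm m) (hpos m) hSc hm hS0
      exact ⟨A, g, fun _ => h⟩
    · exact ⟨0, 0, fun h => absurd h hm⟩
  choose A g hAg using hpot
  have hlocal : ∀ y ∈ G, ∃ s > 0, ∃ M : ℝ, ∀ᶠ m in atTop, ConvexOn ℝ (ball y s) (A m) ∧
      ∀ x ∈ ball y s, A m x ∈ Icc 0 M := by
    intro y hy
    obtain ⟨s, hs, hsG⟩ := nhds_basis_closedBall.mem_iff.1 (hG.mem_nhds hy)
    -- The `L¹` bound requires a compact convex set in `G` containing `S`; the join of the two balls
    -- contains in addition a neighbourhood of `y`.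
    set K := convexJoin ℝ S (closedBall y s)
    have hK : IsCompact K := isCompact_convexJoin hSc (isCompact_closedBall _ _)
    have hKG : K ⊆ G := convexJoin_subset hrG hsG hGc
    have hKc : Convex ℝ K := (convex_closedBall _ _).convexJoin (convex_closedBall _ _)
    have hSK : S ⊆ K := subset_convexJoin_left ⟨y, mem_closedBall_self hs.le⟩
    have hBK : closedBall y s ⊆ K := subset_convexJoin_right ⟨y₀, mem_closedBall_self hr.le⟩
    obtain ⟨C, hC, hCb⟩ := hbd K hKG hK
    set D : ENNReal := Metric.ediam K
    have hD : D ≠ ⊤ := hK.isBounded.ediam_ne_top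
    have hDK : ∀ x ∈ K, ∀ y ∈ K, ‖y - x‖ₑ ≤ D := fun x hx y hy => by
      rw [← edist_eq_enorm_sub]; exact Metric.edist_le_ediam_of_mem hy hx
    set c : ENNReal := D ^ 2 * (2 ^ Module.finrank ℝ E * (μ S + μ K) * C)
    have hc : c ≠ ⊤ := by
      have := hSc.measure_lt_top (μ := μ)
      have := hK.measure_lt_top (μ := μ)
      finiteness
    set β := μ (closedBall y (s / 2))
    have hβ0 : β ≠ 0 := (measure_closedBall_pos μ y (half_pos hs)).ne'
    have hβ1 : β ≠ ⊤ := measure_closedBall_lt_top.ne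
    -- For `x` in the half ball around `y`, the closed ball of radius `s / 2` about `x` stays inside
    -- `K`, and its measure `β` does not depend on `x`. The mean value inequality and the `L¹` bound
    -- then give `A m x ≤ c / (μ S * β)`.
    refine ⟨s / 2, half_pos hs, (c / (μ S * β)).toReal, ?_⟩
    filter_upwards [hCb, hex K hKG hK] with m hm hKU
    obtain ⟨hA, -, hA0, hAc, hAb⟩ := hAg m (hSK.trans hKU)
    have hBU : closedBall y s ⊆ U m := hBK.trans hKU
    refine ⟨hAc.subset ((ball_subset_closedBall.trans (closedBall_subset_closedBall
      (by linarith))).trans hBU) (convex_ball _ _), fun x hx => ⟨hA0 x (hBU ?_), ?_⟩⟩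
    · exact closedBall_subset_closedBall (by linarith) (ball_subset_closedBall hx)
    have hxB : closedBall x (s / 2) ⊆ closedBall y s := by
      refine closedBall_subset_closedBall' ?_
      have := mem_ball.1 hx
      linarith
    have h1 := convexOn_mul_measure_closedBall_le_lintegral (μ := μ) (y := x) (s := s / 2)
      (hAc.subset (hxB.trans hBU) (convex_closedBall _ _))
      (fun a ha => (hA a (hBU (hxB ha))).continuousAt.continuousWithinAt)
      (fun a ha => hA0 a (hBU (hxB ha)))
    rw [Measure.addHaar_closedBall_center, ← Measure.addHaar_closedBall_center μ y] at h1
    have h2 : ENNReal.ofReal (A m x) * (μ S * β) ≤ c := by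
      calc ENNReal.ofReal (A m x) * (μ S * β) = μ S * (ENNReal.ofReal (A m x) * β) := by ring
        _ ≤ μ S * ∫⁻ a in K, ENNReal.ofReal (A m a) ∂μ := by
            gcongr
            exact h1.trans (lintegral_mono_set (hxB.trans hBK))
        _ ≤ D ^ 2 * (2 ^ Module.finrank ℝ E * (μ S + μ K) *
          ∫⁻ x in K, ENNReal.ofReal ‖H m x‖ ∂μ) := hAb K hK hKc hSK hKU D hDK
        _ ≤ c := mul_le_mul_right (mul_le_mul_right hm _) _
    rw [← ENNReal.le_div_iff_mul_le (Or.inl (mul_ne_zero hS0 hβ0))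
      (Or.inl (ENNReal.mul_ne_top hSc.measure_lt_top.ne hβ1))] at h2
    exact (ENNReal.ofReal_le_iff_le_toReal
      (ENNReal.div_ne_top hc (mul_ne_zero hS0 hβ0))).1 h2
  have hex' : ∀ K ⊆ G, IsCompact K → ∀ᶠ m in (hyperfilter ℕ : Filter ℕ), K ⊆ U m :=
    fun K hKG hK => hle (hex K hKG hK)
  have hSU := hex' S hrG hSc
  obtain ⟨f, hf, hlim⟩ := exists_convex_limit (hyperfilter ℕ) hG hGc (F := A)
    (fun y hy => by
      obtain ⟨s, hs, M, h⟩ := hlocal y hy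
      exact ⟨s, hs, M, hle h⟩)
    -- The domain of `A m` varies with `m`, so convexity is known only eventually, separately on
    -- each compact segment.
    (fun x hx y hy => by
      filter_upwards [hSU, hex' (segment ℝ x y) (hGc.segment_subset hx hy)
        (by rw [segment_eq_image_lineMap]; exact isCompact_Icc.image (by fun_prop))] with m hm hs
      exact (hAg m hm).2.2.2.1.subset hs (convex_segment x y))
  refine ⟨f, hf, fun ψ hψ hc hs v w => ?_⟩
  set θ : E → ℝ := fun x => fderiv ℝ (fun y => fderiv ℝ ψ y w) x v
  have hψ1 : ContDiff ℝ 1 (fun y => fderiv ℝ ψ y w) :=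
    (hψ.fderiv_right (m := 1) (by norm_num)).clm_apply contDiff_const
  have hθ : Continuous θ := (hψ1.continuous_fderiv one_ne_zero).clm_apply continuous_const
  have hθs : tsupport θ ⊆ tsupport ψ :=
    (tsupport_fderiv_apply_subset ℝ v).trans (tsupport_fderiv_apply_subset ℝ w)
  have hθc : HasCompactSupport θ := (hc.fderiv_apply ℝ w).fderiv_apply ℝ v
  have hψU := hex' (tsupport ψ) hs hc
  refine (tendsto_integral_mul_of_tendstoUniformlyOn (μ := μ) hθ hθc ?_
    ((hf.continuousOn hG).mono (hθs.trans hs))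
    ((tendstoLocallyUniformlyOn_iff_tendstoUniformlyOn_of_compact hθc).1
      (hlim.mono (hθs.trans hs)))).congr' ?_
  · filter_upwards [hSU, hψU] with m hm hm2 x hx
    exact ((hAg m hm).1 x (hm2 (hθs hx))).continuousAt.continuousWithinAt
  · filter_upwards [hSU, hψU] with m hm hm2
    exact integral_mul_fderiv_fderiv_eq (hAg m hm).1 (hAg m hm).2.1 (hd m).continuousOn hψ hc hm2 v w

end WeakLimit
end Tube

/-! ### Mollification of measures on an open set. -/

namespace Tube
section Mollification
open Filter Topology Metric Set

variable {E : Type*} [NormedAddCommGroup E] [NormedSpace ℝ E] [FiniteDimensional ℝ E]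

/-- The open set of points at distance more than `ε` from the complement of `G`. -/
def shrink (G : Opens E) (ε : ℝ) : Set E := interior {y | closedBall y ε ⊆ G}

theorem isOpen_shrink (G : Opens E) (ε : ℝ) : IsOpen (shrink G ε) := isOpen_interior

theorem closedBall_subset_of_mem_shrink {G : Opens E} {ε : ℝ} {y : E} (hy : y ∈ shrink G ε) :
    closedBall y ε ⊆ G := interior_subset (s := {y | closedBall y ε ⊆ (G : Set E)}) hy

theorem convex_shrink {G : Opens E} (hG : Convex ℝ (G : Set E)) (ε : ℝ) :
    Convex ℝ (shrink G ε) := by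
  refine Convex.interior fun x hx y hy a b ha hb hab z hz => ?_
  -- A point near the convex combination is the same combination of `x` and `y`, both translated by
  -- the same small vector.
  have e : z = a • (x + (z - (a • x + b • y))) + b • (y + (z - (a • x + b • y))) := by
    have : z - (a • x + b • y) = (a + b) • (z - (a • x + b • y)) := by rw [hab, one_smul]
    rw [smul_add, smul_add, add_add_add_comm, ← add_smul, hab, one_smul]
    abel
  have hz' : ‖z - (a • x + b • y)‖ ≤ ε := by rwa [mem_closedBall, dist_eq_norm] at hz
  rw [e]
  refine hG (hx ?_) (hy ?_) ha hb hab <;> simpa [mem_closedBall, dist_eq_norm] using hz'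

theorem eventually_subset_shrink (G : Opens E) {ι : Type*} {l : Filter ι} {ε : ι → ℝ}
    (hε : Tendsto ε l (𝓝 0)) {K : Set E} (hK : IsCompact K) (hKG : K ⊆ G) :
    ∀ᶠ i in l, K ⊆ shrink G (ε i) := by
  obtain ⟨δ, hδ, hδG⟩ := hK.exists_cthickening_subset_open G.isOpen hKG
  filter_upwards [hε.eventually_lt_const (half_pos hδ)] with i hi x hx
  refine mem_interior.2 ⟨ball x (δ / 2), fun y hy z hz => hδG ?_, isOpen_ball,
    mem_ball_self (half_pos hδ)⟩
  refine mem_cthickening_of_dist_le z x δ K hx ?_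
  have h1 := mem_ball.1 hy
  have h2 := mem_closedBall.1 hz
  linarith [dist_triangle z y x]

theorem hasCompactSupport_comp_coe {F : Type*} [Zero F] {G : Opens E} {f : E → F} {K : Set E}
    (hK : IsCompact K) (hKG : K ⊆ G) (hf : ∀ x ∉ K, f x = 0) :
    HasCompactSupport (fun w : G => f w) :=
  HasCompactSupport.intro (K := ((↑) : G → E) ⁻¹' K)
    (Topology.IsInducing.subtypeVal.isCompact_preimage' hK (by simpa using hKG))
    fun w hw => hf w hw

variable [MeasurableSpace E] [BorelSpace E]

section Kernel

variable {G : Opens E} {ν : Measure G} [IsLocallyFiniteMeasure ν] {k : E → ℝ} {ε : ℝ}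

theorem integrable_coe_of_hasCompactSupport {F : Type*} [NormedAddCommGroup F] {f : E → F}
    (hf : Continuous f) (hc : HasCompactSupport f) (hs : tsupport f ⊆ G) :
    Integrable (fun w : G => f w) ν :=
  (hf.comp continuous_subtype_val).integrable_of_hasCompactSupport
    (hasCompactSupport_comp_coe hc hs fun _ hx => image_eq_zero_of_notMem_tsupport hx)

theorem integrable_kernel {F : Type*} [NormedAddCommGroup F] {k : E → F} (hk : Continuous k)
    (hs : ∀ x, ε < ‖x‖ → k x = 0) {y : E}
    (hy : closedBall y ε ⊆ G) : Integrable (fun w : G => k (y - w)) ν :=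
  Continuous.integrable_of_hasCompactSupport (by fun_prop)
    (hasCompactSupport_comp_coe (f := fun w => k (y - w)) (isCompact_closedBall y ε) hy
      fun x hx => hs _ (by simpa [dist_eq_norm, norm_sub_rev] using hx))

theorem fderiv_eq_zero_of_lt_norm (hs : ∀ x, ε < ‖x‖ → k x = 0) (x : E) (hx : ε < ‖x‖) :
    fderiv ℝ k x = 0 := by
  have : k =ᶠ[𝓝 x] fun _ => 0 := by
    filter_upwards [continuous_norm.tendsto x |>.eventually_const_lt hx] with z hz using hs z hz
  rw [this.fderiv_eq]
  simp

/-- Differentiation under the integral: for `x` near `y` the kernels `k (x - ·)` all live in one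
compact `K ⊆ G` of finite `ν`-measure, on which a constant dominates the derivatives. -/
theorem hasFDerivAt_integral_kernel (hk : ContDiff ℝ 1 k) (hs : ∀ x, ε < ‖x‖ → k x = 0) {y : E}
    (hy : y ∈ shrink G ε) :
    HasFDerivAt (fun y => ∫ w : G, k (y - w) ∂ν) (∫ w : G, fderiv ℝ k (y - w) ∂ν) y := by
  obtain ⟨δ, hδ, hδG⟩ := (isCompact_closedBall y ε).exists_cthickening_subset_open G.isOpen
    (closedBall_subset_of_mem_shrink hy)
  set K := cthickening δ (closedBall y ε)
  have hK : IsCompact K := (isCompact_closedBall y ε).cthickening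
  have hDk := hk.continuous_fderiv one_ne_zero
  have hDs := fderiv_eq_zero_of_lt_norm hs
  obtain ⟨C, hC⟩ := hDk.bounded_above_of_compact_support
    (HasCompactSupport.intro (isCompact_closedBall (0 : E) ε) fun x hx =>
      hDs x (by simpa using hx))
  have hKm : MeasurableSet (((↑) : G → E) ⁻¹' K) := hK.measurableSet.preimage measurable_subtype_coe
  have hKc : IsCompact (((↑) : G → E) ⁻¹' K) :=
    Topology.IsInducing.subtypeVal.isCompact_preimage' hK (by simpa using hδG)
  have hball : ∀ x ∈ ball y δ, closedBall x ε ⊆ K := fun x hx z hz => by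
    rcases lt_or_ge ε 0 with hε | hε
    · exact absurd (mem_closedBall.1 hz) (by linarith [dist_nonneg (x := z) (y := x)])
    refine mem_cthickening_of_dist_le z (z - x + y) δ _ ?_ ?_
    · simpa [dist_eq_norm] using hz
    · rw [dist_eq_norm, show z - (z - x + y) = x - y by abel, ← dist_eq_norm]
      exact (mem_ball.1 hx).le
  refine hasFDerivAt_integral_of_dominated_of_fderiv_le
    (bound := (((↑) : G → E) ⁻¹' K).indicator fun _ => C) (F := fun y (w : G) => k (y - w))
    (F' := fun y (w : G) => fderiv ℝ k (y - w)) (ball_mem_nhds y hδ) ?_ ?_ ?_ ?_ ?_ ?_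
  · exact Eventually.of_forall fun x => (by fun_prop : Continuous fun w : G => k (x - w)).aestronglyMeasurable
  · exact integrable_kernel hk.continuous hs (closedBall_subset_of_mem_shrink hy)
  · exact (by fun_prop : Continuous fun w : G => fderiv ℝ k (y - w)).aestronglyMeasurable
  · refine ae_of_all _ fun w x hx => ?_
    by_cases hw : (w : E) ∈ K
    · rw [indicator_of_mem (by exact hw)]
      exact hC _
    · have : ε < ‖x - w‖ := by
        by_contra! h
        exact hw (hball x hx (by simpa [dist_eq_norm, norm_sub_rev] using h))
      rw [hDs _ this, indicator_of_notMem (by exact hw)]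
      simp
  · exact (integrable_indicator_iff hKm).2 (integrableOn_const hKc.measure_lt_top.ne)
  · refine ae_of_all _ fun w x _ => ?_
    exact ((hk.differentiable one_ne_zero (x - w)).hasFDerivAt.comp x
      ((hasFDerivAt_id x).sub_const (w : E)))

variable {μ : Measure E} [μ.IsAddHaarMeasure]

/-- By Tonelli each point `w` of mass contributes at most `∫ k = 1`, and only if it lies in `K'`.
This is the source of the uniform `L¹` bound on mollified coefficients. -/
theorem lintegral_integral_kernel_le (hk : Continuous k) (hk0 : ∀ x, 0 ≤ k x)
    (hs : ∀ x, ε < ‖x‖ → k x = 0) (hk1 : ∫ x, k x ∂μ = 1)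
    {K K' : Set E} (hK' : IsCompact K') (hKK' : ∀ y ∈ K, closedBall y ε ⊆ K') (hKm : MeasurableSet K) :
    ∫⁻ y in K, ENNReal.ofReal (∫ w : G, k (y - w) ∂ν) ∂μ ≤ ν (((↑) : G → E) ⁻¹' K') := by
  have hkc : HasCompactSupport k :=
    HasCompactSupport.intro (isCompact_closedBall (0 : E) ε) fun x hx => hs x (by simpa using hx)
  have hm : Measurable fun p : E × G => ENNReal.ofReal (k (p.1 - p.2)) :=
    ENNReal.measurable_ofReal.comp
      (hk.measurable.comp (measurable_fst.sub (measurable_subtype_coe.comp measurable_snd)))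
  have hK'm : MeasurableSet (((↑) : G → E) ⁻¹' K') :=
    hK'.measurableSet.preimage measurable_subtype_coe
  calc ∫⁻ y in K, ENNReal.ofReal (∫ w : G, k (y - w) ∂ν) ∂μ
      ≤ ∫⁻ y in K, ∫⁻ w : G, ENNReal.ofReal (k (y - w)) ∂ν ∂μ := by
        refine lintegral_mono fun y => ?_
        refine (ENNReal.ofReal_le_ofReal (le_abs_self _)).trans ?_
        rw [← Real.norm_eq_abs, ofReal_norm]
        refine (enorm_integral_le_lintegral_enorm _).trans (le_of_eq ?_)
        refine lintegral_congr fun w => ?_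
        exact Real.enorm_of_nonneg (hk0 _)
    _ = ∫⁻ w : G, ∫⁻ y in K, ENNReal.ofReal (k (y - w)) ∂μ ∂ν :=
        lintegral_lintegral_swap hm.aemeasurable
    _ ≤ ∫⁻ w : G, (((↑) : G → E) ⁻¹' K').indicator (fun _ => 1) w ∂ν := by
        refine lintegral_mono fun w => ?_
        by_cases hw : (w : E) ∈ K'
        · rw [indicator_of_mem (by exact hw)]
          refine (setLIntegral_le_lintegral _ _).trans (le_of_eq ?_)
          rw [lintegral_sub_right_eq_self (fun y => ENNReal.ofReal (k y)) (w : E),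
            ← ofReal_integral_eq_lintegral_ofReal (hk.integrable_of_hasCompactSupport hkc)
              (ae_of_all _ hk0), hk1, ENNReal.ofReal_one]
        · rw [indicator_of_notMem (by exact hw)]
          refine le_of_eq ?_
          rw [setLIntegral_congr_fun hKm (g := fun _ => 0), lintegral_zero]
          intro y hy
          have : ε < ‖y - w‖ := by
            by_contra! h
            exact hw (hKK' y hy (by simpa [dist_eq_norm, norm_sub_rev] using h))
          simp [hs _ this]
    _ = _ := by rw [lintegral_indicator hK'm]; simp

theorem integral_integral_kernel_mul (hk : Continuous k) (hs : ∀ x, ε < ‖x‖ → k x = 0)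
    {ψ : E → ℝ} (hψ : Continuous ψ) (hc : HasCompactSupport ψ)
    (hsub : cthickening ε (tsupport ψ) ⊆ G) (hε : 0 ≤ ε) :
    ∫ y, (∫ w : G, k (y - w) ∂ν) * ψ y ∂μ = ∫ w : G, (∫ y, k y * ψ (y + w) ∂μ) ∂ν := by
  have hK : IsCompact (((↑) : G → E) ⁻¹' (cthickening ε (tsupport ψ))) :=
    Topology.IsInducing.subtypeVal.isCompact_preimage' hc.isCompact.cthickening
      (by simpa using hsub)
  have hint : Integrable (Function.uncurry fun (y : E) (w : G) => k (y - w) * ψ y) (μ.prod ν) := by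
    refine Continuous.integrable_of_hasCompactSupport (by unfold Function.uncurry; fun_prop) ?_
    refine HasCompactSupport.intro (hc.isCompact.prod hK) fun p hp => ?_
    simp only [Function.uncurry]
    by_cases h1 : p.1 ∈ tsupport ψ
    · have h2 : (p.2 : E) ∉ cthickening ε (tsupport ψ) := fun h => hp ⟨h1, h⟩
      rw [hs, zero_mul]
      by_contra! h
      exact h2 (mem_cthickening_of_dist_le _ p.1 ε _ h1
        (by simpa [dist_eq_norm, norm_sub_rev] using h))
    · rw [image_eq_zero_of_notMem_tsupport h1, mul_zero]
  calc ∫ y, (∫ w : G, k (y - w) ∂ν) * ψ y ∂μ = ∫ y, ∫ w : G, k (y - w) * ψ y ∂ν ∂μ := by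
        simp_rw [integral_mul_const]
    _ = ∫ w : G, ∫ y, k (y - w) * ψ y ∂μ ∂ν := integral_integral_swap hint
    _ = _ := by
        refine integral_congr_ae (ae_of_all _ fun w => ?_)
        have := integral_add_right_eq_self (μ := μ) (fun y => k (y - w) * ψ y) (w : E)
        simp only [add_sub_cancel_right] at this
        exact this.symm

/-- Fubini moves the kernel onto `ψ`; the mollified `ψ` tends to `ψ` uniformly, with all supports in
one compact set of finite mass. -/
theorem tendsto_integral_integral_kernel_mul {ι : Type*} {l : Filter ι} {k : ι → E → ℝ}
    {ε : ι → ℝ} (hε : Tendsto ε l (𝓝 0)) (hε0 : ∀ i, 0 ≤ ε i) (hk : ∀ i, Continuous (k i))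
    (hk0 : ∀ i x, 0 ≤ k i x) (hs : ∀ i x, ε i < ‖x‖ → k i x = 0)
    (hk1 : ∀ i, ∫ x, k i x ∂μ = 1) {ψ : E → ℝ} (hψ : Continuous ψ) (hc : HasCompactSupport ψ)
    (hsub : tsupport ψ ⊆ G) :
    Tendsto (fun i => ∫ y, (∫ w : G, k i (y - w) ∂ν) * ψ y ∂μ) l (𝓝 (∫ w : G, ψ w ∂ν)) := by
  obtain ⟨δ, hδ, hδG⟩ := hc.isCompact.exists_cthickening_subset_open G.isOpen hsub
  set K := ((↑) : G → E) ⁻¹' (cthickening δ (tsupport ψ))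
  have hK : IsCompact K :=
    Topology.IsInducing.subtypeVal.isCompact_preimage' hc.isCompact.cthickening
      (by simpa using hδG)
  have hKm : MeasurableSet K := isClosed_cthickening.measurableSet.preimage measurable_subtype_coe
  have hu : UniformContinuous ψ := hc.uniformContinuous_of_continuous hψ
  rw [Metric.tendsto_nhds]
  intro η hη
  set c := ν.real K
  have hc0 : 0 ≤ c := measureReal_nonneg
  obtain ⟨r, hr, hru⟩ := Metric.uniformContinuous_iff.1 hu (η / (c + 1)) (by positivity)
  filter_upwards [hε.eventually_lt_const hδ, hε.eventually_lt_const hr] with i hi hir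
  have hki : Integrable (k i) μ := (hk i).integrable_of_hasCompactSupport
    (HasCompactSupport.intro (isCompact_closedBall (0 : E) (ε i)) fun x hx =>
      hs i x (by simpa using hx))
  have hbd : ∀ w : G, ‖∫ y, k i y * ψ (y + w) ∂μ - ψ w‖ ≤ K.indicator (fun _ => η / (c + 1)) w := by
    intro w
    have e : ∫ y, k i y * ψ (y + w) ∂μ - ψ w = ∫ y, k i y * (ψ (y + w) - ψ w) ∂μ := by
      have h1 : Integrable (fun y => k i y * ψ (y + w)) μ := by
        refine Continuous.integrable_of_hasCompactSupport (by fun_prop) ?_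
        exact (HasCompactSupport.intro (isCompact_closedBall (0 : E) (ε i)) fun x hx =>
          by rw [hs i x (by simpa using hx), zero_mul])
      simp_rw [mul_sub]
      rw [integral_sub h1 (hki.mul_const _), integral_mul_const, hk1, one_mul]
    by_cases hw : w ∈ K
    · rw [indicator_of_mem hw, e]
      calc ‖∫ y, k i y * (ψ (y + w) - ψ w) ∂μ‖ ≤ ∫ y, k i y * (η / (c + 1)) ∂μ := by
            refine norm_integral_le_of_norm_le (hki.mul_const _) (ae_of_all _ fun y => ?_)
            rw [norm_mul, Real.norm_of_nonneg (hk0 i y)]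
            rcases lt_or_ge (ε i) ‖y‖ with h | h
            · simp [hs i y h]
            · refine mul_le_mul_of_nonneg_left ?_ (hk0 i y)
              rw [← dist_eq_norm]
              refine (hru ?_).le
              simpa [dist_eq_norm] using h.trans_lt hir
        _ = η / (c + 1) := by rw [integral_mul_const, hk1, one_mul]
    · rw [indicator_of_notMem hw]
      refine le_of_eq ?_
      have h0 : ψ w = 0 := by
        by_contra h
        exact hw (self_subset_cthickening _ (subset_tsupport _ h))
      rw [h0, sub_zero, norm_eq_zero]
      refine integral_eq_zero_of_ae (ae_of_all _ fun y => ?_)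
      rcases lt_or_ge (ε i) ‖y‖ with h | h
      · simp [hs i y h]
      · have : ψ (y + w) = 0 := by
          by_contra h2
          refine hw (mem_cthickening_of_dist_le _ (y + w) δ _ (subset_tsupport _ h2) ?_)
          simpa [dist_eq_norm] using h.trans hi.le
        simp [this]
  rw [integral_integral_kernel_mul (hk i) (hs i) hψ hc
    ((cthickening_mono hi.le _).trans hδG) (hε0 i), dist_eq_norm]
  have hψi : Integrable (fun w : G => ψ w) ν := integrable_coe_of_hasCompactSupport hψ hc hsub
  have hbi : Integrable (K.indicator (fun _ => η / (c + 1))) ν :=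
    (integrable_indicator_iff hKm).2 (integrableOn_const hK.measure_lt_top.ne)
  have hmeas : AEStronglyMeasurable (fun w : G => ∫ y, k i y * ψ (y + w) ∂μ) ν := by
    have : StronglyMeasurable (Function.uncurry fun (w : G) (y : E) => k i y * ψ (y + w)) :=
      (by unfold Function.uncurry; fun_prop :
        Continuous (Function.uncurry fun (w : G) (y : E) => k i y * ψ (y + w))).stronglyMeasurable
    exact this.integral_prod_right.aestronglyMeasurable
  have hdi : Integrable (fun w : G => ∫ y, k i y * ψ (y + w) ∂μ - ψ w) ν :=
    hbi.mono' (hmeas.sub hψi.aestronglyMeasurable) (ae_of_all _ hbd)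
  have hli : Integrable (fun w : G => ∫ y, k i y * ψ (y + w) ∂μ) ν := by
    refine (hdi.add hψi).congr (ae_of_all _ fun w => ?_)
    simp
  rw [← integral_sub hli hψi]
  calc ‖∫ w : G, (∫ y, k i y * ψ (y + w) ∂μ - ψ w) ∂ν‖
      ≤ ∫ w : G, K.indicator (fun _ => η / (c + 1)) w ∂ν :=
        norm_integral_le_of_norm_le hbi (ae_of_all _ hbd)
    _ = c * (η / (c + 1)) := by rw [integral_indicator hKm]; simp [c]
    _ < η := by
        rw [mul_div_assoc', div_lt_iff₀ (by positivity)]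
        nlinarith

end Kernel
end Mollification
end Tube

/-! ### Distributions on the tube, and what closedness and positivity say on the base. -/

namespace Tube
section TubeDistributions
open Filter Topology Metric Set

variable {n : ℕ} {G : Opens (Fin n → ℝ)}

/-- The point `x + iy`. -/
def ofReIm (x y : Fin n → ℝ) : Fin n → ℂ := fun j => (x j : ℂ) + (y j : ℂ) * Complex.I

@[simp]
theorem rePart_ofReIm (x y : Fin n → ℝ) : rePart (ofReIm x y) = x := by
  ext j; simp [rePart, ofReIm]

@[simp]
theorem imPart_ofReIm (x y : Fin n → ℝ) : imPart (ofReIm x y) = y := by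
  ext j; simp [imPart, ofReIm]

theorem ofReIm_rePart_imPart (z : Fin n → ℂ) : ofReIm (rePart z) (imPart z) = z := by
  ext j; simp [rePart, imPart, ofReIm, Complex.re_add_im]

theorem continuous_rePart : Continuous (rePart : (Fin n → ℂ) → Fin n → ℝ) :=
  continuous_pi fun j => Complex.continuous_re.comp (continuous_apply j)

theorem contDiff_ofReIm : ContDiff ℝ ⊤ fun p : (Fin n → ℝ) × (Fin n → ℝ) => ofReIm p.1 p.2 := by
  refine contDiff_pi.2 fun j => ?_
  have h1 : ContDiff ℝ ⊤ fun p : (Fin n → ℝ) × (Fin n → ℝ) => ((p.1 j : ℝ) : ℂ) :=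
    Complex.ofRealCLM.contDiff.comp
      ((ContinuousLinearMap.proj (R := ℝ) (φ := fun _ : Fin n => ℝ) j).contDiff.comp contDiff_fst)
  have h2 : ContDiff ℝ ⊤ fun p : (Fin n → ℝ) × (Fin n → ℝ) => ((p.2 j : ℝ) : ℂ) :=
    Complex.ofRealCLM.contDiff.comp
      ((ContinuousLinearMap.proj (R := ℝ) (φ := fun _ : Fin n => ℝ) j).contDiff.comp contDiff_snd)
  exact h1.add (h2.mul contDiff_const)

@[fun_prop]
theorem Continuous.ofReIm {X : Type*} [TopologicalSpace X] {f g : X → Fin n → ℝ}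
    (hf : Continuous f) (hg : Continuous g) : Continuous fun x => ofReIm (f x) (g x) :=
  contDiff_ofReIm.continuous.comp (hf.prodMk hg)

theorem mem_tube {z : Fin n → ℂ} : z ∈ tube G ↔ imPart z ∈ G := Iff.rfl

/-! ### Integration against complex Radon measures -/

attribute [instance] RadonMeasure.rePos_locallyFinite RadonMeasure.reNeg_locallyFinite
  RadonMeasure.imPos_locallyFinite RadonMeasure.imNeg_locallyFinite

/-- The integral of a real function against a complex Radon measure. -/
def RadonMeasure.integral (μ : RadonMeasure G) (f : (Fin n → ℝ) → ℝ) : ℂ :=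
  ⟨∫ w : G, f w ∂μ.rePos - ∫ w : G, f w ∂μ.reNeg, ∫ w : G, f w ∂μ.imPos - ∫ w : G, f w ∂μ.imNeg⟩

theorem measurable_ofReIm_coe :
    Measurable fun p : (Fin n → ℝ) × G => ofReIm p.1 (p.2 : Fin n → ℝ) :=
  (by fun_prop : Continuous fun p : (Fin n → ℝ) × G => ofReIm p.1 (p.2 : Fin n → ℝ)).measurable

theorem tensorMeasure_eq (ν : Measure G) : tensorMeasure ν =
    ((volume : Measure (Fin n → ℝ)).prod ν).map fun p => ofReIm p.1 (p.2 : Fin n → ℝ) := rfl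

section PositiveMeasure

variable (ν : Measure G) [IsLocallyFiniteMeasure ν]

theorem locallyIntegrableOn_tensorMeasure :
    LocallyIntegrableOn (fun _ : Fin n → ℂ => (1 : ℂ)) (tube G) (tensorMeasure ν) := by
  rw [locallyIntegrableOn_iff (tube G).isOpen.isLocallyClosed]
  intro K hKG hK
  refine integrableOn_const (ne_of_lt ?_)
  rw [tensorMeasure_eq, Measure.map_apply measurable_ofReIm_coe hK.measurableSet]
  have hK1 : IsCompact (rePart '' K) := hK.image continuous_rePart
  have hK2 : IsCompact (((↑) : G → Fin n → ℝ) ⁻¹' (imPart '' K)) := by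
    refine Topology.IsInducing.subtypeVal.isCompact_preimage' (hK.image continuous_imPart) ?_
    rintro _ ⟨z, hz, rfl⟩
    simpa using mem_tube.1 (hKG hz)
  refine lt_of_le_of_lt (measure_mono ?_) (hK1.prod hK2).measure_lt_top
  rintro ⟨x, y⟩ h
  exact ⟨⟨_, h, rePart_ofReIm x y⟩, ⟨_, h, imPart_ofReIm x y⟩⟩

theorem integrable_comp_ofReIm (φ : TestFunction (tube G) ℝ ⊤) :
    Integrable (fun p : (Fin n → ℝ) × G => φ (ofReIm p.1 p.2)) (volume.prod ν) := by
  have h := TestFunction.integrable (μ := tensorMeasure ν) (n := ⊤) (Ω := tube G) (F := ℝ)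
    (by simpa using (locallyIntegrableOn_tensorMeasure ν).norm) φ
  exact h.comp_measurable measurable_ofReIm_coe

theorem distrOfMeasure_tensorMeasure_apply (φ : TestFunction (tube G) ℝ ⊤) :
    distrOfMeasure (tube G) (tensorMeasure ν) φ =
      ((∫ x : Fin n → ℝ, ∫ y : G, φ (ofReIm x y) ∂ν : ℝ) : ℂ) := by
  refine (TestFunction.integralAgainstBilinCLM_eq_integral
    (locallyIntegrableOn_tensorMeasure ν)).trans ?_
  have : ∀ z, ContinuousLinearMap.lsmul ℝ ℝ (φ z) (1 : ℂ) = ((φ z : ℝ) : ℂ) := fun z => by simp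
  simp_rw [this]
  rw [integral_complex_ofReal, tensorMeasure_eq, integral_map measurable_ofReIm_coe.aemeasurable
    φ.continuous.aestronglyMeasurable]
  congr 1
  exact integral_prod _ (integrable_comp_ofReIm ν φ)

end PositiveMeasure

theorem RadonMeasure.tensorLebesgue_apply (μ : RadonMeasure G) (φ : TestFunction (tube G) ℝ ⊤) :
    μ.tensorLebesgue φ =
      ⟨(∫ x : Fin n → ℝ, ∫ y : G, φ (ofReIm x y) ∂μ.rePos) -
          ∫ x : Fin n → ℝ, ∫ y : G, φ (ofReIm x y) ∂μ.reNeg,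
        (∫ x : Fin n → ℝ, ∫ y : G, φ (ofReIm x y) ∂μ.imPos) -
          ∫ x : Fin n → ℝ, ∫ y : G, φ (ofReIm x y) ∂μ.imNeg⟩ := by
  simp only [RadonMeasure.tensorLebesgue, _root_.add_apply, _root_.sub_apply,
    Distribution.mapCLM_apply, distrOfMeasure_tensorMeasure_apply]
  apply Complex.ext <;> simp

theorem RadonMeasure.re_tensorLebesgue_apply (μ : RadonMeasure G)
    (φ : TestFunction (tube G) ℝ ⊤) :
    (μ.tensorLebesgue φ).re = ∫ x, (μ.integral fun y => φ (ofReIm x y)).re := by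
  rw [μ.tensorLebesgue_apply]
  exact (integral_sub (integrable_comp_ofReIm μ.rePos φ).integral_prod_left
    (integrable_comp_ofReIm μ.reNeg φ).integral_prod_left).symm

theorem RadonMeasure.im_tensorLebesgue_apply (μ : RadonMeasure G)
    (φ : TestFunction (tube G) ℝ ⊤) :
    (μ.tensorLebesgue φ).im = ∫ x, (μ.integral fun y => φ (ofReIm x y)).im := by
  rw [μ.tensorLebesgue_apply]
  exact (integral_sub (integrable_comp_ofReIm μ.imPos φ).integral_prod_left
    (integrable_comp_ofReIm μ.imNeg φ).integral_prod_left).symm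

/-! ### Products of test functions -/

/-- The test function `χ(x) ψ(y)` on the tube. -/
def tensorTest (χ : TestFunction (⊤ : Opens (Fin n → ℝ)) ℝ ⊤) (ψ : TestFunction G ℝ ⊤) :
    TestFunction (tube G) ℝ ⊤ where
  toFun z := χ (rePart z) * ψ (imPart z)
  contDiff' := by
    have h1 : ContDiff ℝ ⊤ (rePart : (Fin n → ℂ) → Fin n → ℝ) := contDiff_pi.2 fun j =>
      Complex.reCLM.contDiff.comp
        (ContinuousLinearMap.proj (R := ℝ) (φ := fun _ : Fin n => ℂ) j).contDiff
    have h2 : ContDiff ℝ ⊤ (imPart : (Fin n → ℂ) → Fin n → ℝ) := contDiff_pi.2 fun j =>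
      Complex.imCLM.contDiff.comp
        (ContinuousLinearMap.proj (R := ℝ) (φ := fun _ : Fin n => ℂ) j).contDiff
    exact (χ.contDiff.comp (h1.of_le le_top)).mul (ψ.contDiff.comp (h2.of_le le_top))
  hasCompactSupport' := by
    refine HasCompactSupport.intro (K := (fun p : (Fin n → ℝ) × (Fin n → ℝ) => ofReIm p.1 p.2) ''
      (tsupport χ ×ˢ tsupport ψ)) ((χ.hasCompactSupport.isCompact.prod
        ψ.hasCompactSupport.isCompact).image (by fun_prop)) fun z hz => ?_
    by_cases h1 : rePart z ∈ tsupport χ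
    · by_cases h2 : imPart z ∈ tsupport ψ
      · exact absurd ⟨(rePart z, imPart z), ⟨h1, h2⟩, ofReIm_rePart_imPart z⟩ hz
      · rw [image_eq_zero_of_notMem_tsupport h2, mul_zero]
    · rw [image_eq_zero_of_notMem_tsupport h1, zero_mul]
  tsupport_subset' := fun z hz => ψ.tsupport_subset
    (tsupport_comp_subset_preimage ψ continuous_imPart (tsupport_mul_subset_right hz))

theorem tensorTest_apply (χ : TestFunction (⊤ : Opens (Fin n → ℝ)) ℝ ⊤) (ψ : TestFunction G ℝ ⊤)
    (z : Fin n → ℂ) : tensorTest χ ψ z = χ (rePart z) * ψ (imPart z) := rfl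

theorem RadonMeasure.tensorLebesgue_tensorTest (μ : RadonMeasure G)
    (χ : TestFunction (⊤ : Opens (Fin n → ℝ)) ℝ ⊤) (ψ : TestFunction G ℝ ⊤) :
    μ.tensorLebesgue (tensorTest χ ψ) = (∫ x, χ x : ℝ) * μ.integral ψ := by
  rw [μ.tensorLebesgue_apply]
  simp only [tensorTest_apply, rePart_ofReIm, imPart_ofReIm, integral_const_mul,
    integral_mul_const]
  apply Complex.ext <;> simp [RadonMeasure.integral] <;> ring

/-- The real part, as a continuous linear map. -/
def rePartCLM (n : ℕ) : (Fin n → ℂ) →L[ℝ] (Fin n → ℝ) :=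
  ContinuousLinearMap.pi fun j => Complex.reCLM ∘L ContinuousLinearMap.proj j

/-- The imaginary part, as a continuous linear map. -/
def imPartCLM (n : ℕ) : (Fin n → ℂ) →L[ℝ] (Fin n → ℝ) :=
  ContinuousLinearMap.pi fun j => Complex.imCLM ∘L ContinuousLinearMap.proj j

theorem rePartCLM_apply (z : Fin n → ℂ) : rePartCLM n z = rePart z := rfl

theorem imPartCLM_apply (z : Fin n → ℂ) : imPartCLM n z = imPart z := rfl

theorem TestFunction.hasFDerivAt {E : Type*} [NormedAddCommGroup E] [NormedSpace ℝ E] {Ω : Opens E}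
    (φ : TestFunction Ω ℝ ⊤) (x : E) : HasFDerivAt φ (fderiv ℝ φ x) x :=
  (φ.contDiff.differentiable (by simp) x).hasFDerivAt

theorem tderiv_tensorTest (χ : TestFunction (⊤ : Opens (Fin n → ℝ)) ℝ ⊤) (ψ : TestFunction G ℝ ⊤)
    (v : Fin n → ℂ) : tderiv v (tensorTest χ ψ) =
      tensorTest (tderiv (rePart v) χ) ψ + tensorTest χ (tderiv (imPart v) ψ) := by
  ext z
  rw [tderiv_apply]
  have h1 : HasFDerivAt (fun z => χ (rePart z)) ((fderiv ℝ χ (rePart z)).comp (rePartCLM n)) z :=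
    (TestFunction.hasFDerivAt χ (rePart z)).comp z (rePartCLM n).hasFDerivAt
  have h2 : HasFDerivAt (fun z => ψ (imPart z)) ((fderiv ℝ ψ (imPart z)).comp (imPartCLM n)) z :=
    (TestFunction.hasFDerivAt ψ (imPart z)).comp z (imPartCLM n).hasFDerivAt
  have h3 : HasFDerivAt (tensorTest χ ψ) _ z := h1.mul h2
  rw [h3.fderiv]
  simp only [tensorTest_apply, tderiv_apply, rePartCLM_apply, imPartCLM_apply, _root_.add_apply,
    _root_.smul_apply, ContinuousLinearMap.comp_apply, smul_eq_mul]
  ring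

theorem integral_tderiv_eq_zero {E : Type*} [NormedAddCommGroup E] [NormedSpace ℝ E]
    [FiniteDimensional ℝ E] [MeasurableSpace E] [BorelSpace E] (μ : Measure E) [μ.IsAddHaarMeasure]
    {ψ : E → ℝ} (hψ : ContDiff ℝ 1 ψ) (hc : HasCompactSupport ψ) (v : E) :
    ∫ x, fderiv ℝ ψ x v ∂μ = 0 := by
  have := integral_mul_fderiv_eq (μ := μ) (U := univ) (A := fun _ => 1) (g := fun _ => 0)
    (fun a _ => hasFDerivAt_const _ _) continuousOn_const hψ hc (subset_univ _) v
  simpa using this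

/-- The term in which the derivative falls on `χ` has `x`-integral zero, so only the imaginary part
of the direction is seen. -/
theorem RadonMeasure.tensorLebesgue_tderiv_tensorTest (μ : RadonMeasure G)
    {χ : TestFunction (⊤ : Opens (Fin n → ℝ)) ℝ ⊤} (hχ : ∫ x, χ x = 1) (ψ : TestFunction G ℝ ⊤)
    (v : Fin n → ℂ) :
    μ.tensorLebesgue (tderiv v (tensorTest χ ψ)) = μ.integral (tderiv (imPart v) ψ) := by
  have h0 : ∫ x, tderiv (rePart v) χ x = 0 := by
    simp_rw [tderiv_apply]
    exact integral_tderiv_eq_zero volume (χ.contDiff.of_le (by simp)) χ.hasCompactSupport _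
  rw [tderiv_tensorTest, map_add, μ.tensorLebesgue_tensorTest, μ.tensorLebesgue_tensorTest, h0, hχ]
  simp

/-- A test function on the whole space with integral one. -/
theorem exists_test_integral_eq_one (G : Opens (Fin n → ℝ)) (hG : (G : Set (Fin n → ℝ)).Nonempty) :
    ∃ χ : TestFunction G ℝ ⊤, (∀ x, 0 ≤ χ x) ∧ ∫ x, χ x = 1 := by
  obtain ⟨y, hy⟩ := hG
  obtain ⟨r, hr, hrG⟩ := nhds_basis_closedBall.mem_iff.1 (G.isOpen.mem_nhds hy)
  let b : ContDiffBump y := ⟨r / 2, r, half_pos hr, by linarith⟩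
  exact ⟨⟨b.normed volume, b.contDiff_normed, b.hasCompactSupport_normed, by
    rw [b.tsupport_normed_eq]; exact hrG⟩, b.nonneg_normed, b.integral_normed⟩

/-! ### Consequences of closedness and positivity -/

section Coefficients

variable {Fhat : Fin n → Fin n → RadonMeasure G}

theorem sum_sum_mul_single_sub (m : Fin n → Fin n → ℂ) (j k : Fin n) (a b : ℂ) :
    (∑ p, ∑ q, m p q * ((Pi.single j a : Fin n → ℂ) p *
      (starRingEnd ℂ) ((Pi.single k b : Fin n → ℂ) q) - (Pi.single k b : Fin n → ℂ) p *
      (starRingEnd ℂ) ((Pi.single j a : Fin n → ℂ) q))) =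
      m j k * (a * (starRingEnd ℂ) b) - m k j * (b * (starRingEnd ℂ) a) := by
  simp only [mul_sub, Finset.sum_sub_distrib]
  congr 1
  · rw [Finset.sum_eq_single j, Finset.sum_eq_single k] <;> simp +contextual
  · rw [Finset.sum_eq_single k, Finset.sum_eq_single j] <;> simp +contextual

theorem closed_relations
    (hclosed : IsClosedCurrent (current11 fun j k => (Fhat j k).tensorLebesgue))
    (ψ : TestFunction G ℝ ⊤) (j k l : Fin n) :
    (Fhat j k).integral (tderiv (Pi.single l 1) ψ) = (Fhat k j).integral (tderiv (Pi.single l 1) ψ) ∧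
    (Fhat j k).integral (tderiv (Pi.single l 1) ψ) =
      (Fhat l k).integral (tderiv (Pi.single j 1) ψ) := by
  obtain ⟨χ, -, hχ⟩ := exists_test_integral_eq_one (⊤ : Opens (Fin n → ℝ)) ⟨0, trivial⟩
  have him : ∀ l : Fin n, imPart (Pi.single l Complex.I : Fin n → ℂ) = Pi.single l 1 := fun l => by
    ext p; by_cases h : p = l
    · subst h; simp [imPart]
    · simp [imPart, h]
  have hre : ∀ l : Fin n, imPart (Pi.single l 1 : Fin n → ℂ) = 0 := fun l => by
    ext p; by_cases h : p = l
    · subst h; simp [imPart]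
    · simp [imPart, h]
  have h0 : ∀ p q, (Fhat p q).integral (tderiv (0 : Fin n → ℝ) ψ) = 0 := fun p q => by
    have : ∀ w, tderiv (0 : Fin n → ℝ) ψ w = 0 := fun w => by rw [tderiv_apply, map_zero]
    simp only [RadonMeasure.integral, this]
    simp
    rfl
  have key : ∀ v, ∑ i : Fin 3, (-1) ^ (i : ℕ) * (current11 fun j k => (Fhat j k).tensorLebesgue)
      (tderiv (v i) (tensorTest χ ψ)) (i.removeNth v) = 0 := fun v => by
    have h1 := extD_apply (current11 fun j k => (Fhat j k).tensorLebesgue) (tensorTest χ ψ) v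
    rw [show extD _ = 0 from hclosed] at h1
    exact (neg_eq_zero.1 h1.symm)
  have hsymm : ∀ j k l, (Fhat j k).integral (tderiv (Pi.single l 1) ψ) =
      (Fhat k j).integral (tderiv (Pi.single l 1) ψ) := by
    intro j k l
    -- On `(i e_l, e_j, e_k)` only the derivative along `i e_l` survives, and `F(e_j, e_k)` is
    -- `(i/2)(F_jk - F_kj)`.
    have := key ![Pi.single l Complex.I, Pi.single j 1, Pi.single k 1]
    simp only [current11_apply, (Fhat _ _).tensorLebesgue_tderiv_tensorTest hχ,
      Fin.sum_univ_three] at this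
    simp [him, hre, h0, Fin.removeNth, sum_sum_mul_single_sub, Fin.succAbove] at this
    exact sub_eq_zero.1 this
  refine ⟨hsymm j k l, ?_⟩
  -- Here two derivatives survive, and `F(i e_j, e_k) = -(F_jk + F_kj)/2`; the symmetry just
  -- obtained merges the two summands.
  have := key ![Pi.single l Complex.I, Pi.single j Complex.I, Pi.single k 1]
  simp only [current11_apply, (Fhat _ _).tensorLebesgue_tderiv_tensorTest hχ,
    Fin.sum_univ_three] at this
  simp [him, hre, h0, Fin.removeNth, sum_sum_mul_single_sub, Fin.succAbove] at this
  rw [hsymm k j l, hsymm k l j] at this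
  linear_combination -this + ((Fhat j k).integral (tderiv (Pi.single l 1) ψ) -
    (Fhat l k).integral (tderiv (Pi.single j 1) ψ)) * Complex.I_sq

/-- Polarization with `e_j + b e_k`: `b = 1` gives opposite imaginary parts and `b = i` gives equal
real parts. -/
theorem hermitian_of_quadratic_im_eq_zero {m : Fin n → Fin n → ℂ}
    (h : ∀ v : Fin n → ℂ, (∑ p, ∑ q, m p q * (v p * (starRingEnd ℂ) (v q))).im = 0) (j k : Fin n) :
    m k j = (starRingEnd ℂ) (m j k) := by
  have hs : ∀ (j k : Fin n) (a b : ℂ), ∑ p, ∑ q, m p q * ((Pi.single j a : Fin n → ℂ) p *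
      (starRingEnd ℂ) ((Pi.single k b : Fin n → ℂ) q)) = m j k * (a * (starRingEnd ℂ) b) := by
    intro j k a b
    rw [Finset.sum_eq_single j, Finset.sum_eq_single k] <;> simp +contextual
  have hd : ∀ j, (m j j).im = 0 := fun j => by
    simpa [hs] using h (Pi.single j 1)
  have hb : ∀ b : ℂ, (m j j + m j k * (starRingEnd ℂ) b + m k j * b +
      m k k * (b * (starRingEnd ℂ) b)).im = 0 := by
    intro b
    rw [← h (Pi.single j 1 + Pi.single k b)]
    congr 1
    simp only [Pi.add_apply, map_add, mul_add, add_mul, Finset.sum_add_distrib, hs]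
    simp
    ring
  have h1 := hb 1
  have h2 := hb Complex.I
  simp [hd] at h1 h2
  apply Complex.ext <;> simp <;> linarith

/-- On `χ ⊗ ψ` the value `F(v, iv)` is the form `∑ F̂_jk(ψ) v_j conj(v_k)`. It is real for all `v`,
hence Hermitian, and real vectors see only its real part. -/
theorem positive_relations
    (hpos : IsPositive11 (current11 fun j k => (Fhat j k).tensorLebesgue))
    (ψ : TestFunction G ℝ ⊤) (hψ : ∀ x, 0 ≤ ψ x) :
    (∀ j k, (Fhat k j).integral ψ = (starRingEnd ℂ) ((Fhat j k).integral ψ)) ∧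
    ∀ p : Fin n → ℝ, 0 ≤ ∑ j, ∑ k, ((Fhat j k).integral ψ).re * p j * p k := by
  obtain ⟨χ, hχ0, hχ⟩ := exists_test_integral_eq_one (⊤ : Opens (Fin n → ℝ)) ⟨0, trivial⟩
  have hS : ∀ v : Fin n → ℂ,
      0 ≤ (∑ p, ∑ q, (Fhat p q).integral ψ * (v p * (starRingEnd ℂ) (v q))).re ∧
      (∑ p, ∑ q, (Fhat p q).integral ψ * (v p * (starRingEnd ℂ) (v q))).im = 0 := by
    intro v
    have h := hpos (tensorTest χ ψ) (fun z => mul_nonneg (hχ0 _) (hψ _)) v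
    have e : current11 (fun j k => (Fhat j k).tensorLebesgue) (tensorTest χ ψ)
        ![v, Complex.I • v] =
        ∑ p, ∑ q, (Fhat p q).integral ψ * (v p * (starRingEnd ℂ) (v q)) := by
      rw [current11_apply, Finset.mul_sum]
      refine Finset.sum_congr rfl fun p _ => ?_
      rw [Finset.mul_sum]
      refine Finset.sum_congr rfl fun q _ => ?_
      rw [(Fhat p q).tensorLebesgue_tensorTest, hχ]
      simp
      linear_combination (-(Fhat p q).integral ψ * v p * (starRingEnd ℂ) (v q)) * Complex.I_sq
    rwa [e] at h
  refine ⟨hermitian_of_quadratic_im_eq_zero fun v => (hS v).2, fun p => ?_⟩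
  convert (hS fun j => (p j : ℂ)).1 using 1
  simp only [Complex.re_sum]
  refine Finset.sum_congr rfl fun j _ => Finset.sum_congr rfl fun k _ => ?_
  rw [Complex.conj_ofReal, ← Complex.ofReal_mul, Complex.re_mul_ofReal]
  ring

end Coefficients
end TubeDistributions
end Tube

/-! ### Solving the Hessian equation on the base by regularization. -/

namespace Tube
section Regularization
open Filter Topology Metric Set

variable {n : ℕ} {G : Opens (Fin n → ℝ)}

theorem exists_mollifiers (E : Type*) [NormedAddCommGroup E] [NormedSpace ℝ E]
    [FiniteDimensional ℝ E] [MeasurableSpace E] [BorelSpace E] (μ : Measure E)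
    [μ.IsAddHaarMeasure] :
    ∃ (k : ℕ → E → ℝ) (ε : ℕ → ℝ), Tendsto ε atTop (𝓝 0) ∧ (∀ m, 0 ≤ ε m) ∧
      (∀ m, ContDiff ℝ (⊤ : ℕ∞) (k m)) ∧ (∀ m x, 0 ≤ k m x) ∧ (∀ m x, ε m < ‖x‖ → k m x = 0) ∧
      ∀ m, ∫ x, k m x ∂μ = 1 := by
  let b : ℕ → ContDiffBump (0 : E) := fun m =>
    ⟨1 / ((m : ℝ) + 1) / 2, 1 / ((m : ℝ) + 1), by positivity, half_lt_self (by positivity)⟩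
  refine ⟨fun m => (b m).normed μ, fun m => 1 / ((m : ℝ) + 1),
    tendsto_one_div_add_atTop_nhds_zero_nat, fun m => by positivity, fun m => (b m).contDiff_normed,
    fun m => (b m).nonneg_normed, fun m x hx => ?_, fun m => (b m).integral_normed⟩
  refine Function.notMem_support.1 ?_
  rw [(b m).support_normed_eq, mem_ball_zero_iff]
  exact not_lt.2 hx.le

section Pairs

variable {k : (Fin n → ℝ) → ℝ} {ε : ℝ} (ν₁ ν₂ : Measure G) [IsLocallyFiniteMeasure ν₁]
  [IsLocallyFiniteMeasure ν₂]

/-- The test function `w ↦ k (y - w)`. -/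
def translateTest (hk : ContDiff ℝ (⊤ : ℕ∞) k) (hs : ∀ x, ε < ‖x‖ → k x = 0) {y : Fin n → ℝ}
    (hy : closedBall y ε ⊆ G) : TestFunction G ℝ ⊤ where
  toFun w := k (y - w)
  contDiff' := hk.comp (contDiff_const.sub contDiff_id)
  hasCompactSupport' := HasCompactSupport.intro (isCompact_closedBall y ε) fun x hx =>
    hs _ (by simpa [dist_eq_norm, norm_sub_rev] using hx)
  tsupport_subset' := by
    refine (closure_minimal ?_ isClosed_closedBall).trans hy
    intro x hx
    by_contra h
    exact hx (hs _ (by simpa [dist_eq_norm, norm_sub_rev] using h))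

theorem tderiv_translateTest (hk : ContDiff ℝ (⊤ : ℕ∞) k) (hs : ∀ x, ε < ‖x‖ → k x = 0)
    {y : Fin n → ℝ} (hy : closedBall y ε ⊆ G) (v w : Fin n → ℝ) :
    tderiv v (translateTest hk hs hy) w = -fderiv ℝ k (y - w) v := by
  rw [tderiv_apply]
  have h : HasFDerivAt (translateTest hk hs hy) (-fderiv ℝ k (y - w)) w := by
    have h1 : HasFDerivAt (fun w => y - w) (-ContinuousLinearMap.id ℝ (Fin n → ℝ)) w :=
      (hasFDerivAt_id w).const_sub y
    refine (((hk.differentiable (by simp) (y - w)).hasFDerivAt).comp w h1).congr_fderiv ?_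
    ext; simp
  rw [h.fderiv]
  rfl

/-- A `y`-derivative of `k (y - w)` is minus its `w`-derivative, so relations between distributional
derivatives of the measures become pointwise relations between derivatives of their mollifications.
-/
theorem exists_hasFDerivAt_sub_integral_kernel (hk : ContDiff ℝ (⊤ : ℕ∞) k)
    (hs : ∀ x, ε < ‖x‖ → k x = 0) {y : Fin n → ℝ} (hy : y ∈ shrink G ε) :
    ∃ D : (Fin n → ℝ) →L[ℝ] ℝ,
      HasFDerivAt (fun y => ∫ w : G, k (y - w) ∂ν₁ - ∫ w : G, k (y - w) ∂ν₂) D y ∧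
      ∀ v, D v = -(∫ w : G, tderiv v (translateTest hk hs
        (closedBall_subset_of_mem_shrink hy)) w ∂ν₁ - ∫ w : G, tderiv v (translateTest hk hs
        (closedBall_subset_of_mem_shrink hy)) w ∂ν₂) := by
  have hk1 : ContDiff ℝ 1 k := hk.of_le (by simp)
  have hi : ∀ (ν : Measure G) [IsLocallyFiniteMeasure ν],
      Integrable (fun w : G => fderiv ℝ k (y - w)) ν := fun ν _ =>
    integrable_kernel (hk1.continuous_fderiv one_ne_zero) (fderiv_eq_zero_of_lt_norm hs)
      (closedBall_subset_of_mem_shrink hy)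
  refine ⟨_, (hasFDerivAt_integral_kernel (ν := ν₁) hk1 hs hy).sub
    (hasFDerivAt_integral_kernel (ν := ν₂) hk1 hs hy), fun v => ?_⟩
  simp only [tderiv_translateTest, integral_neg]
  rw [_root_.sub_apply, ← ContinuousLinearMap.integral_apply (hi ν₁),
    ← ContinuousLinearMap.integral_apply (hi ν₂)]
  ring

theorem tendsto_integral_sub_integral_kernel_mul {k : ℕ → (Fin n → ℝ) → ℝ} {ε : ℕ → ℝ}
    (hε : Tendsto ε atTop (𝓝 0)) (hε0 : ∀ i, 0 ≤ ε i) (hk : ∀ i, ContDiff ℝ 1 (k i))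
    (hk0 : ∀ i x, 0 ≤ k i x) (hs : ∀ i x, ε i < ‖x‖ → k i x = 0)
    (hk1 : ∀ i, ∫ x, k i x = 1) {ψ : (Fin n → ℝ) → ℝ} (hψ : Continuous ψ)
    (hc : HasCompactSupport ψ) (hsub : tsupport ψ ⊆ G) :
    Tendsto (fun i => ∫ y, (∫ w : G, k i (y - w) ∂ν₁ - ∫ w : G, k i (y - w) ∂ν₂) * ψ y) atTop
      (𝓝 (∫ w : G, ψ w ∂ν₁ - ∫ w : G, ψ w ∂ν₂)) := by
  refine ((tendsto_integral_integral_kernel_mul (ν := ν₁) hε hε0 (fun i => (hk i).continuous) hk0 hs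
    hk1 hψ hc hsub).sub (tendsto_integral_integral_kernel_mul (ν := ν₂) hε hε0
    (fun i => (hk i).continuous) hk0 hs hk1 hψ hc hsub)).congr' ?_
  filter_upwards [eventually_subset_shrink G hε hc hsub] with i hi
  have hint : ∀ (ν : Measure G) [IsLocallyFiniteMeasure ν],
      Integrable (fun y => (∫ w : G, k i (y - w) ∂ν) * ψ y) := fun ν _ =>
    integrable_mul_of_tsupport_subset (U := shrink G (ε i)) (fun y hy =>
      (hasFDerivAt_integral_kernel (hk i) (hs i) hy).continuousAt.continuousWithinAt) hψ hc hi
  rw [← integral_sub (hint ν₁) (hint ν₂)]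
  simp_rw [sub_mul]

theorem measurable_integral_kernel (ν : Measure G) [IsLocallyFiniteMeasure ν] (hk : Continuous k) :
    Measurable fun y : Fin n → ℝ => ∫ w : G, k (y - w) ∂ν := by
  have h : Continuous (Function.uncurry fun (y : Fin n → ℝ) (w : G) => k (y - w)) := by
    unfold Function.uncurry; fun_prop
  exact h.stronglyMeasurable.integral_prod_right.measurable

theorem lintegral_integral_sub_integral_kernel_le (hk : Continuous k) (hk0 : ∀ x, 0 ≤ k x)
    (hs : ∀ x, ε < ‖x‖ → k x = 0) (hk1 : ∫ x, k x = 1) {K K' : Set (Fin n → ℝ)}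
    (hK' : IsCompact K') (hKK' : ∀ y ∈ K, closedBall y ε ⊆ K') (hKm : MeasurableSet K) :
    ∫⁻ y in K, ENNReal.ofReal |∫ w : G, k (y - w) ∂ν₁ - ∫ w : G, k (y - w) ∂ν₂| ≤
      ν₁ (((↑) : G → Fin n → ℝ) ⁻¹' K') + ν₂ (((↑) : G → Fin n → ℝ) ⁻¹' K') := by
  calc _ ≤ ∫⁻ y in K, (ENNReal.ofReal (∫ w : G, k (y - w) ∂ν₁) +
        ENNReal.ofReal (∫ w : G, k (y - w) ∂ν₂)) := by
        refine lintegral_mono fun y => ?_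
        have h1 : 0 ≤ ∫ w : G, k (y - w) ∂ν₁ := integral_nonneg fun _ => hk0 _
        have h2 : 0 ≤ ∫ w : G, k (y - w) ∂ν₂ := integral_nonneg fun _ => hk0 _
        rw [← ENNReal.ofReal_add h1 h2]
        exact ENNReal.ofReal_le_ofReal (abs_le.2 ⟨by linarith, by linarith⟩)
    _ ≤ _ := by
        rw [lintegral_add_left (measurable_integral_kernel ν₁ hk).ennreal_ofReal]
        exact add_le_add (lintegral_integral_kernel_le hk hk0 hs hk1 hK' hKK' hKm)
          (lintegral_integral_kernel_le hk hk0 hs hk1 hK' hKK' hKm)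

end Pairs

/-- The bilinear form `(p, q) ↦ p_j q_k`. -/
def coordForm (j k : Fin n) : (Fin n → ℝ) →L[ℝ] (Fin n → ℝ) →L[ℝ] ℝ :=
  (ContinuousLinearMap.proj (R := ℝ) (φ := fun _ : Fin n => ℝ) j).smulRight
    (ContinuousLinearMap.proj (R := ℝ) (φ := fun _ : Fin n => ℝ) k)

theorem clm_apply_eq_sum (D : (Fin n → ℝ) →L[ℝ] ℝ) (p : Fin n → ℝ) :
    D p = ∑ l, p l * D (Pi.single l 1) := by
  conv_lhs => rw [← Finset.univ_sum_single p]
  rw [map_sum]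
  refine Finset.sum_congr rfl fun l _ => ?_
  rw [← smul_eq_mul, ← map_smul, ← Pi.single_smul, smul_eq_mul, mul_one]

theorem coordForm_apply (j k : Fin n) (p q : Fin n → ℝ) : coordForm j k p q = p j * q k := rfl

theorem hasFDerivAt_sum_sum_smul {E F ι κ : Type*} [NormedAddCommGroup E] [NormedSpace ℝ E]
    [NormedAddCommGroup F] [NormedSpace ℝ F] [Fintype ι] [Fintype κ] (B : ι → κ → F)
    {a : E → ι → κ → ℝ} {D : ι → κ → E →L[ℝ] ℝ} {y : E}
    (h : ∀ i j, HasFDerivAt (fun y => a y i j) (D i j) y) :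
    HasFDerivAt (fun y => ∑ i, ∑ j, a y i j • B i j) (∑ i, ∑ j, (D i j).smulRight (B i j)) y :=
  HasFDerivAt.fun_sum fun i _ => HasFDerivAt.fun_sum fun j _ => (h i j).smul_const (B i j)

theorem norm_sum_sum_smul_le {F ι κ : Type*} [NormedAddCommGroup F] [NormedSpace ℝ F] [Fintype ι]
    [Fintype κ] (B : ι → κ → F) (a : ι → κ → ℝ) :
    ‖∑ i, ∑ j, a i j • B i j‖ ≤ ∑ i, ∑ j, ‖B i j‖ * |a i j| := by
  refine (norm_sum_le _ _).trans (Finset.sum_le_sum fun i _ =>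
    (norm_sum_le _ _).trans (Finset.sum_le_sum fun j _ => ?_))
  rw [norm_smul, Real.norm_eq_abs, mul_comm]

/-- The bilinear form with matrix `a`. -/
def bilinForm (a : Fin n → Fin n → ℝ) : (Fin n → ℝ) →L[ℝ] (Fin n → ℝ) →L[ℝ] ℝ :=
  ∑ i, ∑ j, a i j • coordForm i j

theorem bilinForm_apply (a : Fin n → Fin n → ℝ) (p q : Fin n → ℝ) :
    bilinForm a p q = ∑ i, ∑ j, a i j * (p i * q j) := by
  simp [bilinForm, coordForm_apply]

theorem hasFDerivAt_bilinForm {a : (Fin n → ℝ) → Fin n → Fin n → ℝ}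
    {D : Fin n → Fin n → (Fin n → ℝ) →L[ℝ] ℝ} {y : Fin n → ℝ}
    (h : ∀ i j, HasFDerivAt (fun y => a y i j) (D i j) y) :
    HasFDerivAt (fun y => bilinForm (a y))
      (∑ i, ∑ j, (D i j).smulRight (coordForm i j)) y :=
  hasFDerivAt_sum_sum_smul coordForm h

/-- This is the closedness required by the first use of the Poincaré lemma, expanded from basis
vectors by multilinearity. -/
theorem fderiv_bilinForm_exchange {a : (Fin n → ℝ) → Fin n → Fin n → ℝ}
    {D : Fin n → Fin n → (Fin n → ℝ) →L[ℝ] ℝ} {y : Fin n → ℝ}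
    (h : ∀ i j, HasFDerivAt (fun y => a y i j) (D i j) y)
    (hex : ∀ i j l, D i j (Pi.single l 1) = D l j (Pi.single i 1)) (p q : Fin n → ℝ) :
    fderiv ℝ (fun y => bilinForm (a y)) y p q = fderiv ℝ (fun y => bilinForm (a y)) y q p := by
  have e : ∀ p q r, fderiv ℝ (fun y => bilinForm (a y)) y p q r =
      ∑ i, ∑ l, ∑ j, p l * q i * r j * D i j (Pi.single l 1) := by
    intro p q r
    rw [(hasFDerivAt_bilinForm h).fderiv]
    simp only [_root_.sum_apply, ContinuousLinearMap.smulRight_apply, _root_.smul_apply, coordForm_apply, smul_eq_mul]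
    refine Finset.sum_congr rfl fun i _ => ?_
    rw [Finset.sum_comm]
    refine Finset.sum_congr rfl fun j _ => ?_
    rw [clm_apply_eq_sum (D i j) p, Finset.sum_mul]
    exact Finset.sum_congr rfl fun l _ => by ring
  ext r
  rw [e, e, Finset.sum_comm]
  refine Finset.sum_congr rfl fun i _ => Finset.sum_congr rfl fun l _ =>
    Finset.sum_congr rfl fun j _ => ?_
  rw [hex]
  ring

theorem lintegral_norm_bilinForm_le {a : (Fin n → ℝ) → Fin n → Fin n → ℝ}
    (hmeas : ∀ i j, Measurable fun y => a y i j) (K : Set (Fin n → ℝ)) :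
    ∫⁻ y in K, ENNReal.ofReal ‖bilinForm (a y)‖ ≤ ∑ i, ∑ j,
      ENNReal.ofReal ‖coordForm i j‖ * ∫⁻ y in K, ENNReal.ofReal |a y i j| := by
  have hm' : ∀ i j, Measurable fun y => ENNReal.ofReal |a y i j| := fun i j =>
    (continuous_abs.measurable.comp (hmeas i j)).ennreal_ofReal
  calc ∫⁻ y in K, ENNReal.ofReal ‖bilinForm (a y)‖
      ≤ ∫⁻ y in K, ∑ i, ∑ j, ENNReal.ofReal ‖coordForm i j‖ * ENNReal.ofReal |a y i j| := by
        refine lintegral_mono fun y => ?_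
        have h : ‖bilinForm (a y)‖ ≤ ∑ i, ∑ j, ‖coordForm i j‖ * |a y i j| :=
          norm_sum_sum_smul_le coordForm (a y)
        refine (ENNReal.ofReal_le_ofReal h).trans_eq ?_
        rw [ENNReal.ofReal_sum_of_nonneg fun i _ => Finset.sum_nonneg fun j _ => by positivity]
        refine Finset.sum_congr rfl fun i _ => ?_
        rw [ENNReal.ofReal_sum_of_nonneg fun j _ => by positivity]
        exact Finset.sum_congr rfl fun j _ => ENNReal.ofReal_mul (by positivity)
    _ = _ := by
        rw [lintegral_finsetSum _ fun i _ => Finset.measurable_sum _ fun j _ =>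
          (hm' i j).const_mul _]
        refine Finset.sum_congr rfl fun i _ => ?_
        rw [lintegral_finsetSum _ fun j _ => (hm' i j).const_mul _]
        exact Finset.sum_congr rfl fun j _ => lintegral_const_mul _ (hm' i j)

theorem integral_bilinForm_mul {a : (Fin n → ℝ) → Fin n → Fin n → ℝ} {ψ : (Fin n → ℝ) → ℝ}
    (hint : ∀ i j, Integrable fun y => a y i j * ψ y) (p q : Fin n → ℝ) :
    ∫ y, bilinForm (a y) p q * ψ y = ∑ i, ∑ j, p i * q j * ∫ y, a y i j * ψ y := by
  have h : ∀ i j, Integrable fun y => p i * q j * (a y i j * ψ y) := fun i j =>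
    (hint i j).const_mul _
  have e : ∀ y, bilinForm (a y) p q * ψ y = ∑ i, ∑ j, p i * q j * (a y i j * ψ y) := fun y => by
    rw [bilinForm_apply, Finset.sum_mul]
    refine Finset.sum_congr rfl fun i _ => ?_
    rw [Finset.sum_mul]
    exact Finset.sum_congr rfl fun j _ => by ring
  simp_rw [e]
  rw [integral_finsetSum _ fun i _ => integrable_finsetSum _ fun j _ => h i j]
  refine Finset.sum_congr rfl fun i _ => ?_
  rw [integral_finsetSum _ fun j _ => h i j]
  exact Finset.sum_congr rfl fun j _ => integral_const_mul _ _

/-- The theorem on the base `G`, in weak form. It is stated for `C²` functions `ψ` so as to apply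
directly to slices of test functions on the tube. -/
theorem exists_potential_of_closed_hermitian (hG : Convex ℝ (G : Set (Fin n → ℝ)))
    (hGne : (G : Set (Fin n → ℝ)).Nonempty) {Fhat : Fin n → Fin n → RadonMeasure G}
    (hcl : ∀ (ψ : TestFunction G ℝ ⊤) (j k l : Fin n),
      (Fhat j k).integral (tderiv (Pi.single l 1) ψ) =
        (Fhat k j).integral (tderiv (Pi.single l 1) ψ) ∧
      (Fhat j k).integral (tderiv (Pi.single l 1) ψ) =
        (Fhat l k).integral (tderiv (Pi.single j 1) ψ))
    (hpos : ∀ ψ : TestFunction G ℝ ⊤, (∀ x, 0 ≤ ψ x) →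
      (∀ j k, (Fhat k j).integral ψ = (starRingEnd ℂ) ((Fhat j k).integral ψ)) ∧
      ∀ p : Fin n → ℝ, 0 ≤ ∑ j, ∑ k, ((Fhat j k).integral ψ).re * p j * p k) :
    ∃ (A : (Fin n → ℝ) → ℝ) (c : Fin n → Fin n → ℝ), ConvexOn ℝ (G : Set (Fin n → ℝ)) A ∧
      (∀ j k, c k j = -c j k) ∧
      ∀ ψ : (Fin n → ℝ) → ℝ, ContDiff ℝ 2 ψ → HasCompactSupport ψ → tsupport ψ ⊆ G →
        (∀ j k, ((Fhat j k).integral ψ).im = c j k * ∫ y, ψ y) ∧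
        (∀ j k, ((Fhat j k).integral ψ).re = ((Fhat k j).integral ψ).re) ∧
        ∀ v w, ∫ y, A y * fderiv ℝ (fun y => fderiv ℝ ψ y w) y v =
          ∑ j, ∑ k, 4 * ((Fhat j k).integral ψ).re * (w j * v k) := by
  obtain ⟨k, ε, hε, hε0, hk, hk0, hs, hk1⟩ := exists_mollifiers (Fin n → ℝ) volume
  have hkC1 : ∀ m, ContDiff ℝ 1 (k m) := fun m => (hk m).of_le (by simp)
  set U : ℕ → Set (Fin n → ℝ) := fun m => shrink G (ε m)
  set f : ℕ → Fin n → Fin n → (Fin n → ℝ) → ℂ :=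
    fun m i j y => (Fhat i j).integral fun w => k m (y - w)
  have hre := fun m i j y (hy : y ∈ U m) => exists_hasFDerivAt_sub_integral_kernel
    (Fhat i j).rePos (Fhat i j).reNeg (hk m) (hs m) hy
  have him := fun m i j y (hy : y ∈ U m) => exists_hasFDerivAt_sub_integral_kernel
    (Fhat i j).imPos (Fhat i j).imNeg (hk m) (hs m) hy
  choose! Dre hDre hDre' using hre
  choose! Dim hDim hDim' using him
  replace hDre : ∀ m i j, ∀ y ∈ U m, HasFDerivAt (fun y => (f m i j y).re) (Dre m i j y) y := hDre
  replace hDim : ∀ m i j, ∀ y ∈ U m, HasFDerivAt (fun y => (f m i j y).im) (Dim m i j y) y := hDim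
  have hDre_exch : ∀ m i j l, ∀ y ∈ U m,
      Dre m i j y (Pi.single l 1) = Dre m l j y (Pi.single i 1) := fun m i j l y hy => by
    rw [hDre' m i j y hy, hDre' m l j y hy]
    exact congrArg (fun z : ℂ => -z.re) (hcl _ i j l).2
  have hDim_symm : ∀ m i j, ∀ y ∈ U m, Dim m i j y = Dim m j i y := fun m i j y hy => by
    refine ContinuousLinearMap.coe_injective ((Pi.basisFun ℝ (Fin n)).ext fun l => ?_)
    simp only [Pi.basisFun_apply, ContinuousLinearMap.coe_coe]
    rw [hDim' m i j y hy, hDim' m j i y hy]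
    exact congrArg (fun z : ℂ => -z.im) (hcl _ i j l).1
  have hnn : ∀ m y (hy : y ∈ U m), ∀ x, 0 ≤ translateTest (hk m) (hs m)
    (closedBall_subset_of_mem_shrink hy) x := fun m y hy x => hk0 m _
  have hherm : ∀ m i j, ∀ y ∈ U m, f m j i y = (starRingEnd ℂ) (f m i j y) :=
    fun m i j y hy => (hpos _ (hnn m y hy)).1 i j
  have hpsd : ∀ m, ∀ y ∈ U m, ∀ p : Fin n → ℝ, 0 ≤ ∑ i, ∑ j, (f m i j y).re * p i * p j :=
    fun m y hy => (hpos _ (hnn m y hy)).2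
  -- `Im f_ij - Im f_ji` has zero derivative on a convex set, and it equals `2 Im f_ij` because the
  -- matrix is Hermitian.
  have hconst : ∀ m i j, ∃ c : ℝ, ∀ y ∈ U m, (f m i j y).im = c := by
    intro m i j
    obtain ⟨c, hc⟩ := (isOpen_shrink G (ε m)).exists_is_const_of_fderiv_eq_zero (𝕜 := ℝ)
      (f := fun y => (f m i j y).im - (f m j i y).im)
      (convex_shrink hG (ε m)).isPreconnected
      (fun y hy => ((hDim m i j y hy).sub (hDim m j i y hy)).differentiableAt.differentiableWithinAt)
      (fun y hy => by
        refine ((hDim m i j y hy).sub (hDim m j i y hy)).fderiv.trans ?_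
        rw [hDim_symm m i j y hy, sub_self]; rfl)
    refine ⟨c / 2, fun y hy => ?_⟩
    have h1 : (f m i j y).im - (f m j i y).im = c := hc y hy
    have h2 := congrArg Complex.im (hherm m i j y hy)
    rw [Complex.conj_im] at h2
    rw [h2] at h1
    linarith
  choose cm hcm using hconst
  have hlim_re : ∀ i j (ψ : (Fin n → ℝ) → ℝ), Continuous ψ → HasCompactSupport ψ →
      tsupport ψ ⊆ G → Tendsto (fun m => ∫ y, (f m i j y).re * ψ y) atTop
        (𝓝 ((Fhat i j).integral ψ).re) := fun i j ψ hψ hc hsub =>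
    tendsto_integral_sub_integral_kernel_mul _ _ hε hε0 hkC1 hk0 hs hk1 hψ hc hsub
  have hlim_im : ∀ i j (ψ : (Fin n → ℝ) → ℝ), Continuous ψ → HasCompactSupport ψ →
      tsupport ψ ⊆ G → Tendsto (fun m => cm m i j * ∫ y, ψ y) atTop
        (𝓝 ((Fhat i j).integral ψ).im) := by
    intro i j ψ hψ hc hsub
    have h1 : Tendsto (fun m => ∫ y, (f m i j y).im * ψ y) atTop
        (𝓝 ((Fhat i j).integral ψ).im) :=
      tendsto_integral_sub_integral_kernel_mul _ _ hε hε0 hkC1 hk0 hs hk1 hψ hc hsub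
    refine h1.congr' ?_
    filter_upwards [eventually_subset_shrink G hε hc hsub] with m hm
    rw [← integral_const_mul]
    refine integral_congr_ae (ae_of_all _ fun y => ?_)
    by_cases hy : y ∈ tsupport ψ
    · simp only [hcm m i j y (hm hy)]
    · simp [image_eq_zero_of_notMem_tsupport hy]
  -- Pairing with a function of integral one recovers the constants, so they converge and the limit
  -- `c i j` is `Im F̂_ij(ψ₀)`.
  obtain ⟨ψ₀, hψ₀, hψ₀1⟩ := exists_test_integral_eq_one G hGne
  have hcm_lim : ∀ i j, Tendsto (fun m => cm m i j) atTop (𝓝 ((Fhat i j).integral ψ₀).im) := by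
    intro i j
    simpa [hψ₀1] using hlim_im i j ψ₀ ψ₀.continuous ψ₀.hasCompactSupport ψ₀.tsupport_subset
  have hd4 : ∀ m, ∀ y ∈ U m, ∀ i j,
      HasFDerivAt (fun y => 4 * (f m i j y).re) ((4 : ℝ) • Dre m i j y) y := fun m y hy i j =>
    (hDre m i j y hy).const_mul 4
  obtain ⟨A, hA, hAlim⟩ := exists_convex_potential_of_weak_limit (μ := volume) G.isOpen hG hGne
    (U := U) (H := fun m y => bilinForm fun i j => 4 * (f m i j y).re) (fun m => convex_shrink hG _) (fun m => isOpen_shrink _ _)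
    (fun K hKG hK => eventually_subset_shrink G hε hK hKG)
    (fun m y hy => (hasFDerivAt_bilinForm (hd4 m y hy)).differentiableAt.differentiableWithinAt)
    (fun m y hy p q => fderiv_bilinForm_exchange (hd4 m y hy) (fun i j l => by
      simp only [_root_.smul_apply, hDre_exch m i j l y hy]) p q)
    (fun m y hy p q => by
      rw [bilinForm_apply, bilinForm_apply, Finset.sum_comm]
      refine Finset.sum_congr rfl fun i _ => Finset.sum_congr rfl fun j _ => ?_
      rw [hherm m i j y hy, Complex.conj_re, mul_comm (p j)])
    (fun m y hy p => by
      rw [bilinForm_apply]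
      refine (mul_nonneg zero_le_four (hpsd m y hy p)).trans_eq ?_
      simp only [Finset.mul_sum]
      refine Finset.sum_congr rfl fun i _ => Finset.sum_congr rfl fun j _ => ?_
      ring)
    (fun K hKG hK => by
      obtain ⟨δ, hδ, hδG⟩ := hK.exists_cthickening_subset_open G.isOpen hKG
      set K' : Set G := ((↑) : G → Fin n → ℝ) ⁻¹' (cthickening δ K)
      have hK' : IsCompact K' := Topology.IsInducing.subtypeVal.isCompact_preimage'
        hK.cthickening (by simpa using hδG)
      -- Once `ε m ≤ δ`, mollification over `K` only sees the mass in the closed `δ`-thickening of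
      -- `K`.
      refine ⟨∑ i, ∑ j, ENNReal.ofReal ‖coordForm i j‖ * (ENNReal.ofReal 4 *
        ((Fhat i j).rePos K' + (Fhat i j).reNeg K')), ?_, ?_⟩
      · exact ENNReal.sum_ne_top.2 fun i _ => ENNReal.sum_ne_top.2 fun j _ =>
          ENNReal.mul_ne_top ENNReal.ofReal_ne_top (ENNReal.mul_ne_top ENNReal.ofReal_ne_top
            (ENNReal.add_ne_top.2 ⟨hK'.measure_lt_top.ne, hK'.measure_lt_top.ne⟩))
      filter_upwards [hε.eventually_le_const hδ] with m hm
      have hmeas : ∀ i j, Measurable fun y => (f m i j y).re := fun i j =>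
        (measurable_integral_kernel _ (hk m).continuous).sub
          (measurable_integral_kernel _ (hk m).continuous)
      refine (lintegral_norm_bilinForm_le (fun i j => (hmeas i j).const_mul 4) K).trans ?_
      refine Finset.sum_le_sum fun i _ => Finset.sum_le_sum fun j _ => mul_le_mul_right ?_ _
      simp_rw [abs_mul, abs_of_pos (four_pos : (0 : ℝ) < 4),
        ENNReal.ofReal_mul (four_pos : (0 : ℝ) < 4).le]
      have habs : Measurable fun y => ENNReal.ofReal |(f m i j y).re| :=
        (continuous_abs.measurable.comp (hmeas i j)).ennreal_ofReal
      rw [lintegral_const_mul _ habs]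
      refine mul_le_mul_right ?_ _
      exact lintegral_integral_sub_integral_kernel_le _ _ (hk m).continuous (hk0 m) (hs m)
        (hk1 m) hK.cthickening (fun y hy => (closedBall_subset_cthickening hy _).trans
          (cthickening_mono hm _)) hK.measurableSet)
  refine ⟨A, fun i j => ((Fhat i j).integral ψ₀).im, hA, fun i j => ?_, fun ψ hψ hc hsub => ?_⟩
  · simp only [(hpos ψ₀ hψ₀).1 i j, Complex.conj_im]
  refine ⟨fun i j => ?_, fun i j => ?_, fun v w => ?_⟩
  · exact tendsto_nhds_unique (hlim_im i j ψ hψ.continuous hc hsub)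
      ((hcm_lim i j).mul_const _)
  · refine tendsto_nhds_unique (hlim_re i j ψ hψ.continuous hc hsub)
      ((hlim_re j i ψ hψ.continuous hc hsub).congr' ?_)
    filter_upwards [eventually_subset_shrink G hε hc hsub] with m hm
    refine integral_congr_ae (ae_of_all _ fun y => ?_)
    by_cases hy : y ∈ tsupport ψ
    · simp only [hherm m i j y (hm hy), Complex.conj_re]
    · simp [image_eq_zero_of_notMem_tsupport hy]
  -- The integrals converge along `atTop` by weak convergence of the mollified measures, so the
  -- ultrafilter limit must agree.
  · refine tendsto_nhds_unique (hAlim ψ hψ hc hsub v w) (Tendsto.mono_left ?_ Nat.hyperfilter_le_atTop)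
    have hlim : Tendsto (fun m => ∑ i, ∑ j, w i * v j * ∫ y, 4 * (f m i j y).re * ψ y) atTop
        (𝓝 (∑ i, ∑ j, w i * v j * (4 * ((Fhat i j).integral ψ).re))) := by
      refine tendsto_finsetSum _ fun i _ => tendsto_finsetSum _ fun j _ => Tendsto.const_mul _ ?_
      simp_rw [mul_assoc, integral_const_mul]
      exact (hlim_re i j ψ hψ.continuous hc hsub).const_mul _
    have e : ∑ i, ∑ j, 4 * ((Fhat i j).integral ψ).re * (w i * v j) =
        ∑ i, ∑ j, w i * v j * (4 * ((Fhat i j).integral ψ).re) :=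
      Finset.sum_congr rfl fun i _ => Finset.sum_congr rfl fun j _ => by ring
    rw [e]
    refine hlim.congr' ?_
    filter_upwards [eventually_subset_shrink G hε hc hsub] with m hm
    refine (integral_bilinForm_mul (fun i j => ?_) w v).symm
    exact integrable_mul_of_tsupport_subset (U := U m) (fun y hy =>
      (hd4 m y hy i j).continuousAt.continuousWithinAt) hψ.continuous hc hm

end Regularization
end Tube

/-! ### Computing `dd^c` of the potential on the tube. -/

namespace Tube
section TubePotentials
open Filter Topology Metric Set

theorem integral_quadratic_mul_fderiv_fderiv {E : Type*} [NormedAddCommGroup E] [NormedSpace ℝ E]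
    [FiniteDimensional ℝ E] [MeasurableSpace E] [BorelSpace E] (μ : Measure E) [μ.IsAddHaarMeasure]
    (β : E →L[ℝ] E →L[ℝ] ℝ) {ψ : E → ℝ} (hψ : ContDiff ℝ 2 ψ) (hc : HasCompactSupport ψ) (v w : E) :
    ∫ x, β x x * fderiv ℝ (fun y => fderiv ℝ ψ y w) x v ∂μ = (β w v + β v w) * ∫ x, ψ x ∂μ := by
  have hA : ∀ a ∈ (univ : Set E), HasFDerivAt (fun x => β x x) ((β + β.flip) a) a := fun a _ => by
    refine (β.hasFDerivAt.clm_apply (hasFDerivAt_id a)).congr_fderiv ?_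
    ext; simp
  rw [integral_mul_fderiv_fderiv_eq hA (fun a _ => (β + β.flip).hasFDerivAt) continuousOn_const hψ
    hc (subset_univ _) v w, ← integral_const_mul]
  simp

variable {n : ℕ} {G : Opens (Fin n → ℝ)}

theorem measurePreserving_ofReIm :
    MeasurePreserving (fun p : (Fin n → ℝ) × (Fin n → ℝ) => ofReIm p.1 p.2) := by
  have h := (volume_measurePreserving_arrowProdEquivProdArrow ℝ ℝ (Fin n)).comp
    (volume_preserving_pi fun _ : Fin n => Complex.volume_preserving_equiv_real_prod)
  have h' := MeasurePreserving.symm (((MeasurableEquiv.piCongrRight fun _ : Fin n =>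
    Complex.measurableEquivRealProd)).trans (MeasurableEquiv.arrowProdEquivProdArrow ℝ ℝ (Fin n))) h
  convert h' using 1
  ext p j
  apply Complex.ext <;> simp [ofReIm] <;> rfl

/-- The map `(x, y) ↦ x + iy`, as a continuous linear map. -/
def ofReImCLM (n : ℕ) : ((Fin n → ℝ) × (Fin n → ℝ)) →L[ℝ] (Fin n → ℂ) :=
  ContinuousLinearMap.pi fun j =>
    Complex.ofRealCLM ∘L ContinuousLinearMap.proj j ∘L ContinuousLinearMap.fst ℝ _ _ +
      (Complex.I • Complex.ofRealCLM) ∘L ContinuousLinearMap.proj j ∘L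
        ContinuousLinearMap.snd ℝ _ _

theorem ofReImCLM_apply (p : (Fin n → ℝ) × (Fin n → ℝ)) : ofReImCLM n p = ofReIm p.1 p.2 := by
  ext j
  simp [ofReImCLM, ofReIm, mul_comm]

theorem ofReIm_add (x y : Fin n → ℝ) : ofReIm x 0 + ofReIm 0 y = ofReIm x y := by
  ext j; simp [ofReIm]

section Slices

theorem TestFunction.contDiff_two {E : Type*} [NormedAddCommGroup E] [NormedSpace ℝ E]
    {Ω : Opens E} (φ : TestFunction Ω ℝ ⊤) : ContDiff ℝ 2 φ :=
  contDiff_infty.1 φ.contDiff 2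

variable (φ : TestFunction (tube G) ℝ ⊤)

theorem fderiv_imSlice (x y w : Fin n → ℝ) :
    fderiv ℝ (fun y => φ (ofReIm x y)) y w = tderiv (ofReIm 0 w) φ (ofReIm x y) := by
  have h1 : HasFDerivAt (fun y => ofReIm x y)
      (ofReImCLM n ∘L ContinuousLinearMap.inr ℝ (Fin n → ℝ) (Fin n → ℝ)) y := by
    have := (ofReImCLM n).hasFDerivAt.comp y (hasFDerivAt_prodMk_right (𝕜 := ℝ) x y)
    exact this.congr_of_eventuallyEq (Eventually.of_forall fun y => (ofReImCLM_apply (x, y)).symm)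
  rw [show fderiv ℝ (fun y => φ (ofReIm x y)) y = _ from
    ((TestFunction.hasFDerivAt φ (ofReIm x y)).comp y h1).fderiv, tderiv_apply]
  simp [ofReImCLM_apply]

theorem fderiv_reSlice (x y w : Fin n → ℝ) :
    fderiv ℝ (fun x => φ (ofReIm x y)) x w = tderiv (ofReIm w 0) φ (ofReIm x y) := by
  have h1 : HasFDerivAt (fun x => ofReIm x y)
      (ofReImCLM n ∘L ContinuousLinearMap.inl ℝ (Fin n → ℝ) (Fin n → ℝ)) x := by
    have := (ofReImCLM n).hasFDerivAt.comp x (hasFDerivAt_prodMk_left (𝕜 := ℝ) x y)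
    exact this.congr_of_eventuallyEq (Eventually.of_forall fun x => (ofReImCLM_apply (x, y)).symm)
  rw [show fderiv ℝ (fun x => φ (ofReIm x y)) x = _ from
    ((TestFunction.hasFDerivAt φ (ofReIm x y)).comp x h1).fderiv, tderiv_apply]
  simp [ofReImCLM_apply]

theorem contDiff_imSlice (x : Fin n → ℝ) : ContDiff ℝ 2 fun y => φ (ofReIm x y) :=
  (TestFunction.contDiff_two φ).comp
    ((contDiff_ofReIm.of_le le_top).comp (contDiff_const.prodMk contDiff_id))

theorem contDiff_reSlice (y : Fin n → ℝ) : ContDiff ℝ 2 fun x => φ (ofReIm x y) :=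
  (TestFunction.contDiff_two φ).comp
    ((contDiff_ofReIm.of_le le_top).comp (contDiff_id.prodMk contDiff_const))

theorem hasCompactSupport_reSlice (y : Fin n → ℝ) : HasCompactSupport fun x => φ (ofReIm x y) :=
  HasCompactSupport.intro (φ.hasCompactSupport.isCompact.image continuous_rePart) fun x hx =>
    image_eq_zero_of_notMem_tsupport fun h => hx ⟨_, h, rePart_ofReIm x y⟩

theorem imSlice_eq_zero {x y : Fin n → ℝ} (hy : y ∉ imPart '' tsupport φ) : φ (ofReIm x y) = 0 :=
  image_eq_zero_of_notMem_tsupport fun h => hy ⟨_, h, imPart_ofReIm x y⟩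

theorem hasCompactSupport_imSlice (x : Fin n → ℝ) : HasCompactSupport fun y => φ (ofReIm x y) :=
  HasCompactSupport.intro (φ.hasCompactSupport.isCompact.image continuous_imPart) fun _ =>
    imSlice_eq_zero φ

theorem tsupport_imSlice_subset (x : Fin n → ℝ) : tsupport (fun y => φ (ofReIm x y)) ⊆ G := by
  have hK : IsClosed (imPart '' tsupport φ) :=
    (φ.hasCompactSupport.isCompact.image continuous_imPart).isClosed
  refine (closure_minimal (fun y hy => ?_) hK).trans
    (image_subset_iff.2 fun z hz => φ.tsupport_subset hz)
  by_contra h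
  exact hy (imSlice_eq_zero φ h)

theorem integral_tderiv_ofReIm_zero (w y : Fin n → ℝ) :
    ∫ x, tderiv (ofReIm w 0) φ (ofReIm x y) = 0 := by
  simp_rw [← fderiv_reSlice]
  exact integral_tderiv_eq_zero volume ((contDiff_reSlice φ y).of_le (by norm_num))
    (hasCompactSupport_reSlice φ y) w

theorem tderiv_comm (v w : Fin n → ℂ) : tderiv v (tderiv w φ) = tderiv w (tderiv v φ) := by
  ext z
  have hd : DifferentiableAt ℝ (fderiv ℝ φ) z :=
    ((TestFunction.contDiff_two φ).fderiv_right (m := 1) (by norm_num)).differentiable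
      one_ne_zero z
  have e : ∀ v w, tderiv v (tderiv w φ) z = fderiv ℝ (fderiv ℝ φ) z v w := fun v w => by
    have h : (tderiv w φ : (Fin n → ℂ) → ℝ) = fun z => fderiv ℝ φ z w :=
      funext fun z => tderiv_apply _ _ _
    rw [tderiv_apply, h, fderiv_clm_apply hd (differentiableAt_const w)]
    simp
  rw [e, e]
  exact ((TestFunction.contDiff_two φ).contDiffAt.isSymmSndFDerivAt (by simp)) v w

theorem tderiv_add (v w : Fin n → ℂ) : tderiv (v + w) φ = tderiv v φ + tderiv w φ := by
  ext z
  rw [_root_.add_apply, tderiv_apply, tderiv_apply, tderiv_apply, map_add]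

end Slices

section PullbackPotential

variable {A : (Fin n → ℝ) → ℝ} (hA : ContinuousOn A G)
include hA

theorem integrable_imPart_mul (φ : TestFunction (tube G) ℝ ⊤) :
    Integrable fun z => A (imPart z) * φ z :=
  integrable_mul_of_tsupport_subset (U := tube G)
    (hA.comp continuous_imPart.continuousOn fun _ hz => hz) φ.continuous φ.hasCompactSupport
    φ.tsupport_subset

theorem integrable_imPart_mul_ofReIm (φ : TestFunction (tube G) ℝ ⊤) :
    Integrable (fun p : (Fin n → ℝ) × (Fin n → ℝ) => A p.2 * φ (ofReIm p.1 p.2)) := by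
  simpa [Function.comp_def] using
    measurePreserving_ofReIm.integrable_comp_of_integrable (integrable_imPart_mul hA φ)

theorem integral_imPart_mul (φ : TestFunction (tube G) ℝ ⊤) :
    ∫ z, A (imPart z) * φ z = ∫ x, ∫ y, A y * φ (ofReIm x y) := by
  have h := integrable_imPart_mul hA φ
  rw [← measurePreserving_ofReIm.map_eq] at h ⊢
  rw [integral_map measurePreserving_ofReIm.measurable.aemeasurable h.aestronglyMeasurable]
  simp only [imPart_ofReIm]
  exact integral_prod _ (integrable_imPart_mul_ofReIm hA φ)

theorem integral_imPart_mul_tderiv_re (φ : TestFunction (tube G) ℝ ⊤) (v : Fin n → ℝ) :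
    ∫ z, A (imPart z) * tderiv (ofReIm v 0) φ z = 0 := by
  rw [integral_imPart_mul hA, integral_integral_swap
    (integrable_imPart_mul_ofReIm hA (tderiv (ofReIm v 0) φ))]
  simp only [integral_const_mul, integral_tderiv_ofReIm_zero, mul_zero, integral_zero]

/-- `A (imPart z)` does not depend on `x`, so any derivative in a real direction integrates to zero;
after commuting derivatives only the purely imaginary pair remains. -/
theorem integral_imPart_mul_tderiv_tderiv (φ : TestFunction (tube G) ℝ ⊤) (v w : Fin n → ℂ) :
    ∫ z, A (imPart z) * tderiv v (tderiv w φ) z =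
      ∫ x, ∫ y, A y * fderiv ℝ (fun y => fderiv ℝ (fun y => φ (ofReIm x y)) y (imPart w)) y
        (imPart v) := by
  have h : tderiv v (tderiv w φ) = tderiv (ofReIm (rePart v) 0) (tderiv w φ) +
      (tderiv (ofReIm (rePart w) 0) (tderiv (ofReIm 0 (imPart v)) φ) +
        tderiv (ofReIm 0 (imPart v)) (tderiv (ofReIm 0 (imPart w)) φ)) := by
    conv_lhs => rw [← ofReIm_rePart_imPart v, ← ofReIm_add, tderiv_add]
    congr 1
    rw [tderiv_comm φ (ofReIm (rePart w) 0), ← map_add, ← tderiv_add, ofReIm_add,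
      ofReIm_rePart_imPart]
  have e : ∀ z, A (imPart z) * tderiv v (tderiv w φ) z =
      A (imPart z) * tderiv (ofReIm (rePart v) 0) (tderiv w φ) z +
      (A (imPart z) * tderiv (ofReIm (rePart w) 0) (tderiv (ofReIm 0 (imPart v)) φ) z +
        A (imPart z) * tderiv (ofReIm 0 (imPart v)) (tderiv (ofReIm 0 (imPart w)) φ) z) := by
    intro z
    rw [h, _root_.add_apply, _root_.add_apply]
    ring
  have hi : Integrable fun z =>
      A (imPart z) * tderiv (ofReIm (rePart w) 0) (tderiv (ofReIm 0 (imPart v)) φ) z +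
        A (imPart z) * tderiv (ofReIm 0 (imPart v)) (tderiv (ofReIm 0 (imPart w)) φ) z :=
    (integrable_imPart_mul hA _).add (integrable_imPart_mul hA _)
  simp_rw [e]
  rw [integral_add (integrable_imPart_mul hA _) hi,
    integral_add (integrable_imPart_mul hA _) (integrable_imPart_mul hA _),
    integral_imPart_mul_tderiv_re hA, integral_imPart_mul_tderiv_re hA, zero_add, zero_add,
    integral_imPart_mul hA]
  simp_rw [fderiv_imSlice]

end PullbackPotential

theorem distrOfFun_apply {u : (Fin n → ℂ) → ℝ} {Ω : Opens (Fin n → ℂ)} (hu : ContinuousOn u Ω)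
    (φ : TestFunction Ω ℝ ⊤) : distrOfFun Ω u φ = ((∫ z, u z * φ z : ℝ) : ℂ) := by
  have hl : LocallyIntegrableOn (fun z => (u z : ℂ)) Ω :=
    (Complex.continuous_ofReal.comp_continuousOn hu).locallyIntegrableOn Ω.isOpen.measurableSet
  refine (TestFunction.integralAgainstBilinCLM_eq_integral hl).trans ?_
  rw [← integral_complex_ofReal]
  refine integral_congr_ae (ae_of_all _ fun z => ?_)
  simp [mul_comm]

/-- Antisymmetry pairs `(j, k)` with `(k, j)` and kills the diagonal. The full double sum is a
bilinear form on the diagonal, which is easier to differentiate. -/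
theorem sum_sum_Ioi_antisymm {c : Fin n → Fin n → ℝ} (hc : ∀ j k, c k j = -c j k)
    (x y : Fin n → ℝ) :
    ∑ j, ∑ k ∈ Finset.Ioi j, 2 * c j k * (x j * y k - y j * x k) =
      ∑ j, ∑ k, 2 * c j k * (x j * y k) := by
  have h0 : ∀ j, c j j = 0 := fun j => by linarith [hc j j]
  have h1 := Finset.sum_sum_Ioi_add_eq_sum_sum_off_diag fun k j => 2 * c j k * (x j * y k)
  have h2 : ∀ j, ∑ k ∈ ({j}ᶜ : Finset (Fin n)), 2 * c j k * (x j * y k) =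
      ∑ k, 2 * c j k * (x j * y k) := fun j => by
    rw [← Finset.sum_compl_add_sum {j}, Finset.sum_singleton, h0]
    simp
  simp_rw [← h2, ← h1]
  refine Finset.sum_congr rfl fun j _ => Finset.sum_congr rfl fun k _ => ?_
  rw [hc j k]
  ring

/-- The two sides of the final identity evaluated on vectors `v`, `w`, with `s` standing for `∫ φ`.
Equality fails term by term and holds only after adding the `(j, k)` and `(k, j)` terms, hence the
antisymmetric discrepancy `X`. -/
theorem hermitian_sum_eq {R c : Fin n → Fin n → ℝ} (hR : ∀ j k, R k j = R j k)
    (hc : ∀ j k, c k j = -c j k) (s : ℝ) (v w : Fin n → ℂ) :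
    Complex.I / 2 * ∑ j, ∑ k, ((R j k : ℂ) + Complex.I * (c j k * s)) *
        (v j * (starRingEnd ℂ) (w k) - w j * (starRingEnd ℂ) (v k)) =
      1 / 4 * (((∑ j, ∑ k, (4 * R j k * (imPart w j * imPart (Complex.I • v) k) +
          2 * c j k * (rePart w j * imPart (Complex.I • v) k +
            rePart (Complex.I • v) j * imPart w k) * s) : ℝ) : ℂ) -
        ((∑ j, ∑ k, (4 * R j k * (imPart v j * imPart (Complex.I • w) k) +
          2 * c j k * (rePart v j * imPart (Complex.I • w) k +
            rePart (Complex.I • w) j * imPart v k) * s) : ℝ) : ℂ)) := by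
  rw [← sub_eq_zero]
  set X : Fin n → Fin n → ℂ := fun j k =>
    Complex.I / 2 * (((R j k : ℂ) + Complex.I * (c j k * s)) *
        (v j * (starRingEnd ℂ) (w k) - w j * (starRingEnd ℂ) (v k))) -
      1 / 4 * (((4 * R j k * (imPart w j * imPart (Complex.I • v) k) +
          2 * c j k * (rePart w j * imPart (Complex.I • v) k +
            rePart (Complex.I • v) j * imPart w k) * s : ℝ) : ℂ) -
        ((4 * R j k * (imPart v j * imPart (Complex.I • w) k) +
          2 * c j k * (rePart v j * imPart (Complex.I • w) k +
            rePart (Complex.I • w) j * imPart v k) * s : ℝ) : ℂ)) with hX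
  have hXX : ∀ j k, X j k + X k j = 0 := fun j k => by
    simp only [hX, hR j k, hc j k]
    apply Complex.ext <;> simp [rePart, imPart] <;> ring
  have hS : ∑ j, ∑ k, X j k = 0 := by
    have h : ∑ j, ∑ k, X j k + ∑ j, ∑ k, X j k = 0 := by
      nth_rw 2 [Finset.sum_comm]
      simp only [← Finset.sum_add_distrib, hXX, Finset.sum_const_zero]
    exact self_eq_neg.1 (eq_neg_of_add_eq_zero_left h)
  rw [← hS]
  simp only [hX, Finset.sum_sub_distrib, ← Finset.mul_sum, Complex.ofReal_sum]

theorem current11_eq_ddc {Fhat : Fin n → Fin n → RadonMeasure G} {A : (Fin n → ℝ) → ℝ}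
    {c : Fin n → Fin n → ℝ} (hA : ContinuousOn A G) (hc : ∀ j k, c k j = -c j k)
    (h : ∀ ψ : (Fin n → ℝ) → ℝ, ContDiff ℝ 2 ψ → HasCompactSupport ψ → tsupport ψ ⊆ G →
        (∀ j k, ((Fhat j k).integral ψ).im = c j k * ∫ y, ψ y) ∧
        (∀ j k, ((Fhat j k).integral ψ).re = ((Fhat k j).integral ψ).re) ∧
        ∀ v w, ∫ y, A y * fderiv ℝ (fun y => fderiv ℝ ψ y w) y v =
          ∑ j, ∑ k, 4 * ((Fhat j k).integral ψ).re * (w j * v k)) :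
    current11 (fun j k => (Fhat j k).tensorLebesgue) = ddc (tube G) fun z =>
      A (imPart z) + ∑ j, ∑ k ∈ Finset.Ioi j,
        2 * c j k * (rePart z j * imPart z k - imPart z j * rePart z k) := by
  -- The polynomial part of the potential is `z ↦ β z z`; its Hessian is constant, so it pairs with
  -- second derivatives of `φ` as a multiple of `∫ φ`.
  set β := (bilinForm fun j k => 2 * c j k).bilinearComp (rePartCLM n) (imPartCLM n)
  have hβ : ∀ z w, β z w = ∑ j, ∑ k, 2 * c j k * (rePart z j * imPart w k) := fun z w =>
    bilinForm_apply _ _ _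
  simp_rw [sum_sum_Ioi_antisymm hc, ← hβ]
  have hAim : ContinuousOn (fun z => A (imPart z)) (tube G) :=
    hA.comp continuous_imPart.continuousOn fun _ hz => hz
  have hβc : Continuous fun z => β z z := by fun_prop
  ext φ v
  -- The base identities hold for each slice of `φ` at fixed `x`; integrating in `x` gives the tube
  -- identities for arbitrary `φ`.
  have hslice := fun x => h _ (contDiff_imSlice φ x) (hasCompactSupport_imSlice φ x)
    (tsupport_imSlice_subset φ x)
  set R : Fin n → Fin n → ℝ := fun j k => ((Fhat j k).tensorLebesgue φ).re
  have hR : ∀ j k, R k j = R j k := fun j k => by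
    simp only [R, RadonMeasure.re_tensorLebesgue_apply]
    exact integral_congr_ae (ae_of_all _ fun x => (hslice x).2.1 k j)
  have hφint : ∫ z, φ z = ∫ x, ∫ y, φ (ofReIm x y) := by
    simpa using integral_imPart_mul (A := fun _ => 1) continuousOn_const φ
  have hF : ∀ j k, (Fhat j k).tensorLebesgue φ = R j k + Complex.I * (c j k * (∫ z, φ z : ℝ)) := by
    intro j k
    apply Complex.ext
    · simp [R]
    · rw [RadonMeasure.im_tensorLebesgue_apply, hφint]
      simp only [(hslice _).1, integral_const_mul]
      simp
  have hint : ∀ j k, Integrable fun x => ((Fhat j k).integral fun y => φ (ofReIm x y)).re :=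
    fun j k => (integrable_comp_ofReIm _ φ).integral_prod_left.sub
      (integrable_comp_ofReIm _ φ).integral_prod_left
  have hT : ∀ v w, distrOfFun (tube G) (fun z => A (imPart z) + β z z) (tderiv v (tderiv w φ)) =
      ((∑ j, ∑ k, (4 * R j k * (imPart w j * imPart v k) +
        2 * c j k * (rePart w j * imPart v k + rePart v j * imPart w k) * ∫ z, φ z) : ℝ) : ℂ) := by
    intro v w
    rw [distrOfFun_apply (u := fun z => A (imPart z) + β z z) (hAim.add hβc.continuousOn)]
    congr 1
    simp_rw [add_mul]
    rw [integral_add (integrable_imPart_mul hA _) (integrable_mul_of_tsupport_subset (U := univ)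
      hβc.continuousOn (tderiv v (tderiv w φ)).continuous (tderiv v (tderiv w φ)).hasCompactSupport
      (subset_univ _))]
    simp only [Finset.sum_add_distrib]
    congr 1
    · rw [integral_imPart_mul_tderiv_tderiv hA]
      simp_rw [(hslice _).2.2]
      have hi : ∀ j k, Integrable fun x => 4 * ((Fhat j k).integral fun y => φ (ofReIm x y)).re *
          (imPart w j * imPart v k) := fun j k => ((hint j k).const_mul 4).mul_const _
      rw [integral_finsetSum _ fun i _ => integrable_finsetSum _ fun j _ => hi i j]
      refine Finset.sum_congr rfl fun i _ => ?_
      rw [integral_finsetSum _ fun j _ => hi i j]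
      refine Finset.sum_congr rfl fun j _ => ?_
      rw [integral_mul_const, integral_const_mul]
      simp only [R, RadonMeasure.re_tensorLebesgue_apply]
    · have h2 : ∀ z, tderiv v (tderiv w φ) z = fderiv ℝ (fun y => fderiv ℝ φ y w) z v := fun z => by
        rw [tderiv_apply]
        congr 2
      simp_rw [h2]
      rw [integral_quadratic_mul_fderiv_fderiv volume β (TestFunction.contDiff_two φ)
        φ.hasCompactSupport v w, hβ, hβ]
      simp only [mul_add, add_mul, Finset.sum_add_distrib, Finset.sum_mul]
  rw [current11_apply, ddc_apply, hT, hT]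
  simp only [hF]
  exact hermitian_sum_eq hR hc _ (v 0) (v 1)

theorem testFunction_eq_zero_of_isEmpty (hG : ¬(G : Set (Fin n → ℝ)).Nonempty)
    (φ : TestFunction (tube G) ℝ ⊤) : φ = 0 := by
  ext z
  refine image_eq_zero_of_notMem_tsupport fun h => hG ⟨_, φ.tsupport_subset h⟩

end TubePotentials
end Tube
end

theorem proposition3p1 {n : ℕ} (G : TopologicalSpace.Opens (Fin n → ℝ))
    (hG : Convex ℝ (G : Set (Fin n → ℝ)))
    (F : Tube.Current (Tube.tube G) 2)
    (Fhat : Fin n → Fin n → Tube.RadonMeasure G)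
    (hF : F = Tube.current11 (fun j k => (Fhat j k).tensorLebesgue))
    (hclosed : Tube.IsClosedCurrent F)
    (hpos : Tube.IsPositive11 F) :
    ∃ (A : (Fin n → ℝ) → ℝ) (c : Fin n → Fin n → ℝ),
      ConvexOn ℝ (G : Set (Fin n → ℝ)) A ∧
      F = Tube.ddc (Tube.tube G) (fun z =>
        A (Tube.imPart z) +
          ∑ j : Fin n, ∑ k ∈ Finset.Ioi j,
            2 * c j k *
              (Tube.rePart z j * Tube.imPart z k - Tube.imPart z j * Tube.rePart z k)) := by
  by_cases hne : (G : Set (Fin n → ℝ)).Nonempty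
  · subst hF
    obtain ⟨A, c, hA, hc, h⟩ := Tube.exists_potential_of_closed_hermitian hG hne
      (Tube.closed_relations hclosed) (Tube.positive_relations hpos)
    exact ⟨A, c, hA, Tube.current11_eq_ddc (hA.continuousOn G.isOpen) hc h⟩
  -- Over an empty base the only test function is zero, so any two currents agree. The main argument
  -- needs a ball in `G` to normalize on.
  · refine ⟨fun _ => 0, fun _ _ => 0, convexOn_const 0 hG, ?_⟩
    ext φ : 1
    rw [Tube.testFunction_eq_zero_of_isEmpty hne φ, map_zero, map_zero]
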